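/- Rankings of $d$ items are permutations $\pi\in\mathfrak S_d$, where $\pi(i)$ is the position of item $i$. For $\pi_0\in\mathfrak S_d$ and $\phi\in[0,1]$, the Mallows distribution $\mathcal M(\pi_0,\phi)$ gives $\pi$ the probability $\phi^{D_\tau(\pi_0,\pi)}/Z(\phi)$ (with $0^0=1$), where the Kendall tau distance $D_\tau(\pi_0,\pi)$ is the number of item pairs that $\pi_0$ and $\pi$ order differently and $Z(\phi)=\sum_{\sigma}\phi^{D_\tau(\pi_0,\sigma)}$. For $S\subseteq\mathfrak S_d$ with $\mathcal M(S)>0$, the truncation $\mathcal M_S$ is $\mathcal M$ conditioned on $S$. For items $i,j$, let $\mathrm{flip}(\pi,i,j)$ be $\pi$ with $i$ and $j$ swapped. For $\alpha>0$, $\mathcal M_S$ is neighboring $\alpha$-fat if $\mathbb P_{\pi\sim\mathcal M_S}[\mathrm{flip}(\pi,i,j)\in S]\ge\alpha$ for all items $i,j$ with $|\pi_0(i)-\pi_0(j)|=1$. A learner is a (possibly randomized) sequential procedure that has membership access to $S$, draws i.i.d. samples from $\mathcal M_S$ one at a time, and decides from its coins, $S$ and the samples drawn so far whether to draw another sample or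 to stop with an output. Its sample count is random. **Theorem.** There is a universal constant $C>0$, and for every $\gamma>0$ a constant $K=K(\gamma)>0$, such that the following holds for all $d\ge 0$ and $\delta\in(0,1)$, with the convention that $\log 0=0$. (i) There is a learner (depending on $d,\gamma,\delta$) such that, for all $\pi_0\in\mathfrak S_d$, all $\phi\in[0,1]$ with $\phi\le 1-\gamma$, all $\alpha>0$ and all neighboring $\alpha$-fat truncations $\mathcal M_S$ of $\mathcal M(\pi_0,\phi)$, it outputs $\pi_0$ with probability at least $1-\delta$, and its expected number of samples from $\mathcal M_S$ is at most $$C\,\frac{\log(d)\,\log(d/\delta)}{\gamma^2\alpha}.$$ (ii) Suppose that $d\ge2$. For every $\varepsilon>0$ and $\pi_0\in\mathfrak S_d$ there is a learner (depending on $d,\gamma,\delta,\varepsilon,\pi_0$) such that, for all $\phi\in[0,1]$ with $\phi\le 1-\gamma$, all $\alpha>0$ and all neighboring $\alpha$-fat truncations $\mathcal M_S$ of $\mathcal M(\pi_0,\phi)$, it outputs $\hat\phi\in\mathbb R$ with $|\phi-\hat\phi|\le C\varepsilon$ with probability at least $1-\delta$, and its expected number of samples from $\mathcal M_S$ is at most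 $$C\,\frac{\log(1/\delta)}{\varepsilon^2\alpha}.$$ (iii) For every $\varepsilon>0$ there is a learner (depending on $d,\gamma,\delta,\varepsilon$) whose output is a pair $(\hat\pi,\hat\phi)\in\mathfrak S_d\times[0,1]$ such that, for all $\pi_0\in\mathfrak S_d$, all $\phi\in[0,1]$ with $\phi\le 1-\gamma$, all $\alpha>0$ and all neighboring $\alpha$-fat truncations $\mathcal M_S$ of $\mathcal M(\pi_0,\phi)$, with probability at least $1-\delta$ both $\hat\pi=\pi_0$ and $$D_{TV}\bigl(\mathcal M(\pi_0,\phi),\mathcal M(\hat\pi,\hat\phi)\bigr)\le K\varepsilon,$$ where $D_{TV}(P,Q)=\frac12\sum_{\pi}|P(\pi)-Q(\pi)|$, and its expected number of samples from $\mathcal M_S$ is at most $$C\left(\frac{\log(d)\,\log(d/\delta)}{\gamma^2\alpha}+\frac{d\,\log(1/\delta)}{\varepsilon^2\alpha}\right).$$ -/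

import Mathlib

open MeasureTheory
open scoped ENNReal

/-- A ranking of the `d` items `Fin d`: `π i` is the position of item `i`. -/
abbrev Ranking (d : ℕ) : Type := Equiv.Perm (Fin d)

instance Ranking.instMeasurableSpace (d : ℕ) : MeasurableSpace (Ranking d) := ⊤

instance Ranking.instDiscreteMeasurableSpace (d : ℕ) : DiscreteMeasurableSpace (Ranking d) :=
  ⟨fun _ => trivial⟩

/-- The Kendall tau distance: the number of item pairs `i < j` on which `π` and `σ` disagree. -/
def kendallTau {d : ℕ} (π σ : Ranking d) : ℕ :=
  (Finset.univ.filter fun p : Fin d × Fin d =>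
    p.1 < p.2 ∧
      ((π p.1 : ℤ) - (π p.2 : ℤ)) * ((σ p.1 : ℤ) - (σ p.2 : ℤ)) < 0).card

theorem kendallTau_self {d : ℕ} (π : Ranking d) : kendallTau π π = 0 := by
  unfold kendallTau
  rw [Finset.card_eq_zero, Finset.filter_eq_empty_iff]
  rintro p - ⟨-, h⟩
  exact absurd h (not_lt.mpr (mul_self_nonneg _))

/-- The unnormalized Mallows weight `φ ^ D(π₀, π)` (with `0 ^ 0 = 1`). -/
noncomputable def mallowsWeight {d : ℕ} (π₀ : Ranking d) (φ : unitInterval) (π : Ranking d) :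
    ℝ≥0∞ :=
  ENNReal.ofReal ((φ : ℝ) ^ kendallTau π₀ π)

theorem tsum_mallowsWeight_ne_zero {d : ℕ} (π₀ : Ranking d) (φ : unitInterval) :
    (∑' π, mallowsWeight π₀ φ π) ≠ 0 := by
  intro h
  have h1 := ENNReal.tsum_eq_zero.mp h π₀
  simp [mallowsWeight, kendallTau_self] at h1

theorem tsum_mallowsWeight_ne_top {d : ℕ} (π₀ : Ranking d) (φ : unitInterval) :
    (∑' π, mallowsWeight π₀ φ π) ≠ ∞ := by
  rw [tsum_fintype]
  exact ENNReal.sum_ne_top.mpr fun _ _ => ENNReal.ofReal_ne_top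

/-- The Mallows distribution with central ranking `π₀` and spread parameter `φ ∈ [0, 1]`:
the probability of `π` is `φ ^ D(π₀, π)` divided by `Z(φ) = ∑ σ, φ ^ D(π₀, σ)`. -/
noncomputable def mallows {d : ℕ} (π₀ : Ranking d) (φ : unitInterval) : PMF (Ranking d) :=
  PMF.normalize (mallowsWeight π₀ φ) (tsum_mallowsWeight_ne_zero π₀ φ)
    (tsum_mallowsWeight_ne_top π₀ φ)

/-- The truncation of the Mallows distribution by a set `S` of positive probability:
the probability of `π ∈ S` is `M(π) / M(S)`, and `0` outside `S`. -/
noncomputable def truncatedMallows {d : ℕ} (π₀ : Ranking d) (φ : unitInterval)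
    (S : Set (Ranking d)) (hS : ∃ π ∈ S, π ∈ (mallows π₀ φ).support) : PMF (Ranking d) :=
  (mallows π₀ φ).filter S hS

/-- The ranking `π` with the items `i` and `j` swapped. -/
def flipItems {d : ℕ} (π : Ranking d) (i j : Fin d) : Ranking d :=
  π * Equiv.swap i j

/-- The truncated ranking distribution `Q`, with truncation set `S`, is `α`-fat for `(i, j)`. -/
def IsFatForPair {d : ℕ} (Q : PMF (Ranking d)) (S : Set (Ranking d)) (α : ℝ) (i j : Fin d) :
    Prop :=
  ENNReal.ofReal α ≤ Q.toMeasure {π | flipItems π i j ∈ S}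

/-- The truncation of `M(π₀, φ)` by `S` is neighboring `α`-fat: it is `α`-fat for all pairs of
items that occupy neighboring positions in the central ranking `π₀`. -/
def IsNeighboringFat {d : ℕ} (π₀ : Ranking d) (φ : unitInterval) (S : Set (Ranking d))
    (hS : ∃ π ∈ S, π ∈ (mallows π₀ φ).support) (α : ℝ) : Prop :=
  ∀ i j : Fin d, |(π₀ i : ℤ) - (π₀ j : ℤ)| = 1 →
    IsFatForPair (truncatedMallows π₀ φ S hS) S α i j

/-- The total variation distance of two distributions on a finite set. -/
noncomputable def tvDist {X : Type*} [Fintype X] (P Q : PMF X) : ℝ :=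
  (1 / 2) * ∑ x, |(P x).toReal - (Q x).toReal|

/-- A sequential learner that draws samples in `X`, has membership access to a set `S` of
samples, and may toss coins: `coins` is the law of its internal randomness. With internal
randomness `u`, truncation set `S` and the list `l` of the samples drawn so far, it draws one
more sample if `act u S l = none`, and stops with output `o` if `act u S l = some o`. -/
structure Learner (X Out : Type*) where
  coins : PMF ℕ
  act : ℕ → Set X → List X → Option Out

namespace Learner

variable {X Out : Type*} [MeasurableSpace X]

/-- The number of samples drawn on the sample sequence `x` (`⊤` if the learner never stops). -/
noncomputable def sampleCount (L : Learner X Out) (S : Set X) (u : ℕ) (x : ℕ → X) : ℝ≥0∞ :=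
  ⨅ (n : ℕ) (_ : (L.act u S ((List.range n).map x)).isSome), (n : ℝ≥0∞)

/-- On the sample sequence `x`, the learner stops, and its output is `o`. -/
def Outputs (L : Learner X Out) (S : Set X) (u : ℕ) (x : ℕ → X) (o : Out) : Prop :=
  ∃ n : ℕ, L.act u S ((List.range n).map x) = some o ∧
    ∀ m < n, L.act u S ((List.range m).map x) = none

/-- The joint law of the internal randomness and an independent sequence of i.i.d. samples
from `Q`. -/
noncomputable def runLaw (L : Learner X Out) (Q : PMF X) : Measure (ℕ × (ℕ → X)) :=
  L.coins.toMeasure.prod (Measure.infinitePi fun _ : ℕ => Q.toMeasure)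

/-- The expected number of samples drawn from `Q`. -/
noncomputable def expectedSamples (L : Learner X Out) (S : Set X) (Q : PMF X) : ℝ≥0∞ :=
  ∫⁻ ω, L.sampleCount S ω.1 ω.2 ∂(L.runLaw Q)

/-- The probability that the learner stops with an output that satisfies `good`. -/
noncomputable def successProb (L : Learner X Out) (S : Set X) (Q : PMF X) (good : Out → Prop) :
    ℝ≥0∞ :=
  L.runLaw Q {ω | ∃ o, L.Outputs S ω.1 ω.2 o ∧ good o}

end Learner

/-! Fix items `i`, `j` with `π₀ i < π₀ j`, and call a sample informative for the pair if swapping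
the two items stays in `S`. The swap is an involution that pairs the informative rankings inside
`S`, and the normalizing constant of the truncation cancels within each pair. Swapping a concordant
pair raises the Kendall distance by at least one, and by exactly one if `i` and `j` are neighbors in
`π₀`. So, among informative samples, the mass of disagreement with `π₀` is at most `φ` times the
mass of agreement (`flipMass_swap_le`), with equality for neighbors (`flipMass_swap_eq`). Fatness
says that samples are informative for a neighboring pair with probability at least `α`.

Center: give each pair the score "informative votes for `i` before `j` minus votes against". Since
the odds against are at most `1 - γ ≤ exp (-γ)`, `exp (γ * score)` in the wrong direction is a
nonnegative supermartingale, and Ville's inequality bounds the chance that a wrong score ever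
reaches `h` by `exp (-γ h)`. The learner stops when some ranking has score `h` on all its
consecutive pairs. A ranking other than `π₀` has a consecutive pair that `π₀` orders the other way
(`eq_of_neighbors_lt`), so a union over at most `d ^ 2` pairs suffices, with no union over rankings
or times. A Chernoff bound with a geometric tail shows that `π₀` itself is accepted after `O(log (d
/ δ) / (γ ^ 2 α))` expected samples; the extra factor `log d` is slack.

Spread: for the first two items of the center, the frequency of disagreement among informative
samples tends to `φ / (1 + φ)`. The learner waits for a prescribed number of informative samples.
Concentration is proved on the scale of square roots (`measure_exists_sqrt_ratio_le`), uniformly in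
time, so it holds at any later stopping time too.

Distribution: with a common center, the Hellinger affinity of two Mallows laws is `Z(ab) / √(Z(a ^
2) Z(b ^ 2))`, where `a = √φ`, `b = √ψ`. The product formula for `Z` splits it into `d` factors,
each within `K (a - b) ^ 2` of one after squaring, so the total variation distance is `O(√d |a -
b|)`. Hence accuracy `ε / √d` for `√φ` is enough, which costs the factor `d` in the sample count. -/

/-! ### I.i.d. sequences: Ville's and Chernoff's inequalities, waiting times. -/

section IIDSequences

variable {X : Type*} [MeasurableSpace X]

/-- The sequence with first term `p.1`, followed by the terms of `p.2`. -/
def seqCons (p : X × (ℕ → X)) : ℕ → X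
  | 0 => p.1
  | n + 1 => p.2 n

theorem measurable_seqCons : Measurable (seqCons : X × (ℕ → X) → ℕ → X) := by
  refine measurable_pi_lambda _ fun n => ?_
  cases n with
  | zero => exact measurable_fst
  | succ n => exact (measurable_pi_apply n).comp measurable_snd

/-- The law of an i.i.d. sequence splits into its first term and an independent tail. -/
theorem map_seqCons_prod_infinitePi (μ : Measure X) [IsProbabilityMeasure μ] :
    (μ.prod (Measure.infinitePi fun _ : ℕ => μ)).map seqCons =
      Measure.infinitePi fun _ : ℕ => μ := by
  classical
  refine Measure.eq_infinitePi _ fun s t ht => ?_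
  have hbox : (∏ i ∈ s, μ (t i)) =
      ∏ i ∈ s, μ (if i ∈ s then t i else Set.univ) :=
    Finset.prod_congr rfl fun i hi => by rw [if_pos hi]
  -- Padding the box with `Set.univ` makes its index set an initial segment, from which the index
  -- `0` can be split off.
  set t' : ℕ → Set X := fun i => if i ∈ s then t i else Set.univ with ht'
  have ht'm : ∀ i, MeasurableSet (t' i) := fun i => by
    simp only [ht']; split_ifs
    exacts [ht i, MeasurableSet.univ]
  obtain ⟨N, hN⟩ : ∃ N, s ⊆ Finset.range (N + 1) := by
    refine ⟨s.sup id, fun i hi => ?_⟩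
    exact Finset.mem_range.mpr (Nat.lt_succ_of_le (Finset.le_sup (f := id) hi))
  have hset : Set.pi (↑s) t = Set.pi (↑(Finset.range (N + 1))) t' := by
    ext x
    simp only [Set.mem_pi, Finset.mem_coe, ht']
    constructor
    · intro h i _
      split_ifs with his
      exacts [h i his, Set.mem_univ _]
    · intro h i hi
      have := h i (hN hi)
      rwa [if_pos hi] at this
  have hpre : seqCons ⁻¹' (Set.pi (↑(Finset.range (N + 1))) t') =
      t' 0 ×ˢ Set.pi (↑(Finset.range N)) (fun i => t' (i + 1)) := by
    ext p
    simp only [Set.mem_preimage, Set.mem_pi, Finset.coe_range, Set.mem_Iio, Set.mem_prod]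
    constructor
    · intro h
      exact ⟨h 0 (Nat.succ_pos _), fun i hi => h (i + 1) (by omega)⟩
    · rintro ⟨h0, h⟩ i hi
      cases i with
      | zero => exact h0
      | succ i => exact h i (by omega)
  have hprod : (∏ i ∈ s, μ (t' i)) = ∏ i ∈ Finset.range (N + 1), μ (t' i) := by
    refine Finset.prod_subset hN fun i _ hi => ?_
    simp [ht', hi]
  rw [hbox, hset, Measure.map_apply measurable_seqCons
    (MeasurableSet.pi (Finset.range (N + 1)).countable_toSet fun i _ => ht'm i), hpre,
    Measure.prod_prod, Measure.infinitePi_pi _ fun i _ => ht'm _]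
  change _ = ∏ i ∈ s, μ (t' i)
  rw [hprod, Finset.prod_range_succ', mul_comm]

theorem measurable_sum_range {f : X → ℝ} (hf : Measurable f) (n : ℕ) :
    Measurable fun ω : ℕ → X => ∑ i ∈ Finset.range n, f (ω i) :=
  Finset.measurable_sum _ fun i _ => hf.comp (measurable_pi_apply i)

/-- Finite-horizon form of Ville's inequality, by conditioning on the first term: after a first
value `f x` the tail must reach `c - f x`, which has probability at most `exp (-c) * exp (f x)`, and
the exponential moment integrates this to `exp (-c)`. For `c ≤ 0` the bound is at least one; for `c
> 0` the empty sum cannot reach `c`, so a first term exists. -/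
theorem measure_exists_le_sum_range_le (μ : Measure X) [IsProbabilityMeasure μ] {f : X → ℝ}
    (hf : Measurable f) (h1 : ∫⁻ x, ENNReal.ofReal (Real.exp (f x)) ∂μ ≤ 1) (N : ℕ) (c : ℝ) :
    (Measure.infinitePi fun _ : ℕ => μ)
        {ω | ∃ n ≤ N, c ≤ ∑ i ∈ Finset.range n, f (ω i)} ≤
      ENNReal.ofReal (Real.exp (-c)) := by
  induction N generalizing c with
  | zero =>
    rcases le_or_gt c 0 with hc | hc
    · refine prob_le_one.trans ?_
      rw [← ENNReal.ofReal_one]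
      exact ENNReal.ofReal_le_ofReal (Real.one_le_exp (by linarith))
    · have : {ω : ℕ → X | ∃ n ≤ 0, c ≤ ∑ i ∈ Finset.range n, f (ω i)} = ∅ := by
        ext ω
        simp [hc]
      rw [this]
      simp
  | succ N ih =>
    rcases le_or_gt c 0 with hc | hc
    · refine prob_le_one.trans ?_
      rw [← ENNReal.ofReal_one]
      exact ENNReal.ofReal_le_ofReal (Real.one_le_exp (by linarith))
    · have hmeas : ∀ (M : ℕ),
          MeasurableSet {p : X × (ℕ → X) |
            ∃ n ≤ M, c ≤ f p.1 + ∑ i ∈ Finset.range n, f (p.2 i)} := fun M => by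
        have : {p : X × (ℕ → X) | ∃ n ≤ M, c ≤ f p.1 + ∑ i ∈ Finset.range n, f (p.2 i)} =
            ⋃ n ∈ Set.Iic M,
              {p : X × (ℕ → X) | c ≤ f p.1 + ∑ i ∈ Finset.range n, f (p.2 i)} := by
          ext p; simp
        rw [this]
        refine MeasurableSet.biUnion (Set.to_countable _) fun n _ => ?_
        exact measurableSet_le measurable_const
          ((hf.comp measurable_fst).add ((measurable_sum_range hf n).comp measurable_snd))
      have hmeas' : MeasurableSet {ω : ℕ → X | ∃ n ≤ N + 1, c ≤ ∑ i ∈ Finset.range n, f (ω i)} := by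
        have : {ω : ℕ → X | ∃ n ≤ N + 1, c ≤ ∑ i ∈ Finset.range n, f (ω i)} =
            ⋃ n ∈ Set.Iic (N + 1), {ω : ℕ → X | c ≤ ∑ i ∈ Finset.range n, f (ω i)} := by
          ext p; simp
        rw [this]
        exact MeasurableSet.biUnion (Set.to_countable _) fun n _ =>
          measurableSet_le measurable_const (measurable_sum_range hf n)
      have hpre : seqCons ⁻¹' {ω : ℕ → X | ∃ n ≤ N + 1, c ≤ ∑ i ∈ Finset.range n, f (ω i)} =
          {p : X × (ℕ → X) | ∃ n ≤ N, c ≤ f p.1 + ∑ i ∈ Finset.range n, f (p.2 i)} := by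
        ext p
        simp only [Set.mem_preimage, Set.mem_ofPred_eq]
        constructor
        · rintro ⟨n, hn, h⟩
          cases n with
          | zero => simp at h; linarith
          | succ n =>
            refine ⟨n, by omega, ?_⟩
            rw [Finset.sum_range_succ'] at h
            simpa [seqCons, add_comm] using h
        · rintro ⟨n, hn, h⟩
          refine ⟨n + 1, by omega, ?_⟩
          rw [Finset.sum_range_succ']
          simpa [seqCons, add_comm] using h
      rw [← map_seqCons_prod_infinitePi, Measure.map_apply measurable_seqCons hmeas', hpre,
        Measure.prod_apply (hmeas N)]
      calc _ ≤ ∫⁻ x, ENNReal.ofReal (Real.exp (-c)) * ENNReal.ofReal (Real.exp (f x)) ∂μ := by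
            refine lintegral_mono fun x => ?_
            rw [← ENNReal.ofReal_mul (Real.exp_pos _).le, ← Real.exp_add]
            refine le_trans (le_of_eq ?_) ((ih (c - f x)).trans (le_of_eq ?_))
            · simp only [sub_le_iff_le_add']
              rfl
            · congr 2; ring
        _ ≤ ENNReal.ofReal (Real.exp (-c)) := by
            rw [lintegral_const_mul _ (by fun_prop)]
            exact mul_le_of_le_one_right (by simp) h1

/-- Ville's inequality for the exponential of a sum of i.i.d. terms. -/
theorem measure_exists_le_sum_le (μ : Measure X) [IsProbabilityMeasure μ] {f : X → ℝ}
    (hf : Measurable f) (h1 : ∫⁻ x, ENNReal.ofReal (Real.exp (f x)) ∂μ ≤ 1) (c : ℝ) :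
    (Measure.infinitePi fun _ : ℕ => μ)
        {ω | ∃ n, c ≤ ∑ i ∈ Finset.range n, f (ω i)} ≤
      ENNReal.ofReal (Real.exp (-c)) := by
  have hU : {ω : ℕ → X | ∃ n, c ≤ ∑ i ∈ Finset.range n, f (ω i)} =
      ⋃ N : ℕ, {ω | ∃ n ≤ N, c ≤ ∑ i ∈ Finset.range n, f (ω i)} := by
    ext ω
    simp only [Set.mem_ofPred_eq, Set.mem_iUnion]
    exact ⟨fun ⟨n, h⟩ => ⟨n, n, le_rfl, h⟩, fun ⟨_, n, _, h⟩ => ⟨n, h⟩⟩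
  have hmono : Monotone fun N : ℕ =>
      {ω : ℕ → X | ∃ n ≤ N, c ≤ ∑ i ∈ Finset.range n, f (ω i)} :=
    fun M N hMN ω ⟨n, hn, h⟩ => ⟨n, hn.trans hMN, h⟩
  rw [hU, hmono.measure_iUnion]
  exact iSup_le fun N => measure_exists_le_sum_range_le μ hf h1 N c

/-- Chernoff's bound for a sum of i.i.d. terms. -/
theorem measure_le_sum_le (μ : Measure X) [IsProbabilityMeasure μ] {f : X → ℝ}
    (hf : Measurable f) {r : ℝ} (hr : 0 < r)
    (h1 : ∫⁻ x, ENNReal.ofReal (Real.exp (f x)) ∂μ ≤ ENNReal.ofReal r) (c : ℝ) (n : ℕ) :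
    (Measure.infinitePi fun _ : ℕ => μ)
        {ω | c ≤ ∑ i ∈ Finset.range n, f (ω i)} ≤
      ENNReal.ofReal (Real.exp (-c) * r ^ n) := by
  -- Subtracting `log r` from each term brings the exponential moment down to one, so Ville's
  -- inequality applies and is then used at the single time `n`.
  have h2 : ∫⁻ x, ENNReal.ofReal (Real.exp (f x - Real.log r)) ∂μ ≤ 1 := by
    have : ∀ x, ENNReal.ofReal (Real.exp (f x - Real.log r)) =
        ENNReal.ofReal (Real.exp (f x)) * ENNReal.ofReal r⁻¹ := fun x => by
      rw [← ENNReal.ofReal_mul (Real.exp_pos _).le, Real.exp_sub, Real.exp_log hr, div_eq_mul_inv]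
    simp_rw [this]
    rw [lintegral_mul_const _ (by fun_prop)]
    calc _ ≤ ENNReal.ofReal r * ENNReal.ofReal r⁻¹ := by gcongr
      _ = 1 := by rw [← ENNReal.ofReal_mul hr.le, mul_inv_cancel₀ hr.ne', ENNReal.ofReal_one]
  have h3 := measure_exists_le_sum_le μ (f := fun x => f x - Real.log r)
    (hf.sub measurable_const) h2 (c - n * Real.log r)
  refine (measure_mono fun ω hω => ?_).trans (h3.trans (le_of_eq ?_))
  · refine ⟨n, ?_⟩
    rw [Finset.sum_sub_distrib]
    simpa using hω
  · rw [neg_sub, sub_eq_add_neg, add_comm, Real.exp_add, mul_comm (n : ℝ), Real.exp_mul,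
      Real.exp_log hr, Real.rpow_natCast]

/-- An event about the first `n` terms of a sequence in a finite discrete space is measurable. -/
theorem measurableSet_prefix [Finite X] [DiscreteMeasurableSpace X] (P : List X → Prop) (n : ℕ) :
    MeasurableSet {ω : ℕ → X | P ((List.range n).map ω)} := by
  have hm : Measurable fun (ω : ℕ → X) (i : Fin n) => ω i :=
    measurable_pi_lambda _ fun i => measurable_pi_apply _
  have := hm (MeasurableSet.of_discrete (s := {v : Fin n → X | P (List.ofFn v)}))
  convert this using 1
  ext ω
  simp only [Set.mem_ofPred_eq, Set.mem_preimage]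
  rw [List.ofFn_eq_map, ← List.map_coe_finRange_eq_range, List.map_map]
  rfl

end IIDSequences

theorem sum_map_map_range {X : Type*} (f : X → ℝ) (ω : ℕ → X) (n : ℕ) :
    ((((List.range n).map ω).map f).sum) = ∑ i ∈ Finset.range n, f (ω i) := by
  induction n with
  | zero => simp
  | succ n ih => rw [List.range_succ, Finset.sum_range_succ, ← ih]; simp

/-- A geometric tail bound controls the sum of probabilities by the logarithm of its constant. -/
theorem tsum_min_one_geometric_le {A ρ : ℝ} (hA : 1 ≤ A) (hρ : 0 < ρ) (hρ1 : ρ < 1) :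
    ∑' n : ℕ, min 1 (ENNReal.ofReal (A * (1 - ρ) ^ n)) ≤
      ENNReal.ofReal ((Real.log A + 2) / ρ) := by
  have hlog : 0 ≤ Real.log A := Real.log_nonneg hA
  -- Up to `n₀`, about `log A / ρ`, the trivial bound one is used; from there on `A` is absorbed and
  -- a geometric series of sum `1 / ρ` remains. Rounding up costs one more, which is at most `1 /
  -- ρ`.
  obtain ⟨n₀, hn₀, hn₀'⟩ : ∃ n₀ : ℕ, Real.log A / ρ ≤ n₀ ∧ (n₀ : ℝ) ≤ Real.log A / ρ + 1 :=
    ⟨_, Nat.le_ceil _, (Nat.ceil_lt_add_one (div_nonneg hlog hρ.le)).le⟩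
  have hpow : A * (1 - ρ) ^ n₀ ≤ 1 := by
    have h1 : (1 - ρ) ^ n₀ ≤ Real.exp (-ρ) ^ n₀ := by
      have := Real.add_one_le_exp (-ρ)
      exact pow_le_pow_left₀ (by linarith) (by linarith) _
    rw [← Real.exp_nat_mul] at h1
    have h2 : Real.log A ≤ n₀ * ρ := by
      rwa [div_le_iff₀ hρ] at hn₀
    calc A * (1 - ρ) ^ n₀ ≤ Real.exp (Real.log A) * Real.exp (n₀ * -ρ) := by
          rw [Real.exp_log (by linarith)]
          gcongr
      _ = Real.exp (Real.log A - n₀ * ρ) := by rw [← Real.exp_add]; congr 1; ring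
      _ ≤ 1 := Real.exp_le_one_iff.mpr (by linarith)
  rw [← Summable.sum_add_tsum_nat_add' (k := n₀) ENNReal.summable]
  have h1 : ∑ i ∈ Finset.range n₀, min 1 (ENNReal.ofReal (A * (1 - ρ) ^ i)) ≤
      ENNReal.ofReal n₀ := by
    refine (Finset.sum_le_sum fun i _ => min_le_left _ _).trans ?_
    simp
  have h2 : ∑' i : ℕ, min 1 (ENNReal.ofReal (A * (1 - ρ) ^ (i + n₀))) ≤
      ENNReal.ofReal (1 / ρ) := by
    calc _ ≤ ∑' i : ℕ, ENNReal.ofReal ((1 - ρ) ^ i) := by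
          refine ENNReal.tsum_le_tsum fun i => (min_le_right _ _).trans ?_
          refine ENNReal.ofReal_le_ofReal ?_
          have hp : 0 ≤ (1 - ρ) ^ i := pow_nonneg (by linarith) _
          rw [pow_add]
          nlinarith
      _ = ENNReal.ofReal (1 / ρ) := by
          rw [← ENNReal.ofReal_tsum_of_nonneg (fun i => pow_nonneg (by linarith) _)
            (summable_geometric_of_lt_one (by linarith) (by linarith)),
            tsum_geometric_of_lt_one (by linarith) (by linarith)]
          congr 1; rw [one_div]; congr 1; ring
  refine (add_le_add h1 h2).trans ?_
  rw [← ENNReal.ofReal_add (by positivity) (by positivity)]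
  refine ENNReal.ofReal_le_ofReal ?_
  have : 1 ≤ 1 / ρ := by rw [le_div_iff₀ hρ]; linarith
  calc _ ≤ Real.log A / ρ + 1 / ρ + 1 / ρ := by linarith
    _ = _ := by ring

/-! ### Combinatorics of the Kendall tau distance. -/

/-- The pairs of items that `π` orders as listed and `σ` orders the other way round. -/
def discordantPairs {d : ℕ} (π σ : Ranking d) : Finset (Fin d × Fin d) :=
  Finset.univ.filter fun p => π p.1 < π p.2 ∧ σ p.2 < σ p.1

theorem mem_discordantPairs {d : ℕ} {π σ : Ranking d} {p : Fin d × Fin d} :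
    p ∈ discordantPairs π σ ↔ π p.1 < π p.2 ∧ σ p.2 < σ p.1 := by
  simp [discordantPairs]

/-- Each unordered pair is reoriented: by item labels on one side, by the order in `π` on the other.
The second form is the one on which item swaps act conveniently. -/
theorem kendallTau_eq_card {d : ℕ} (π σ : Ranking d) :
    kendallTau π σ = (discordantPairs π σ).card := by
  have key : ∀ x y : Fin d, ((π x : ℤ) - (π y : ℤ)) * ((σ x : ℤ) - (σ y : ℤ)) < 0 ↔
      (π x < π y ∧ σ y < σ x) ∨ (π y < π x ∧ σ x < σ y) := fun x y => by
    rw [mul_neg_iff]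
    simp only [Fin.lt_def]
    omega
  unfold kendallTau
  refine Finset.card_bij' (fun p _ => if π p.1 < π p.2 then p else p.swap)
    (fun p _ => if p.1 < p.2 then p else p.swap) ?_ ?_ ?_ ?_
  · rintro ⟨x, y⟩ h
    simp only [Finset.mem_filter, key] at h
    rw [mem_discordantPairs]
    dsimp only
    split_ifs with h1
    · rcases h.2.2 with h2 | h2
      exacts [h2, absurd h1 (lt_asymm h2.1)]
    · rcases h.2.2 with h2 | h2
      exacts [absurd h2.1 h1, h2]
  · rintro ⟨x, y⟩ h
    rw [mem_discordantPairs] at h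
    simp only [Finset.mem_filter, Finset.mem_univ, true_and, key]
    split_ifs with h1
    · exact ⟨h1, Or.inl h⟩
    · refine ⟨lt_of_le_of_ne (not_lt.mp h1) ?_, Or.inr h⟩
      intro he
      have he' : y = x := he
      subst he'
      exact lt_irrefl _ h.1
  · rintro ⟨x, y⟩ h
    simp only [Finset.mem_filter] at h
    dsimp only
    by_cases h1 : π x < π y
    · simp [h1, h.2.1]
    · simp [h1, not_lt.mpr h.2.1.le]
  · rintro ⟨x, y⟩ h
    rw [mem_discordantPairs] at h
    dsimp only at h ⊢
    by_cases h1 : x < y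
    · simp [h1, h.1]
    · simp [h1, not_lt.mpr h.1.le]

theorem flipItems_apply {d : ℕ} (π : Ranking d) (i j k : Fin d) :
    flipItems π i j k = π (Equiv.swap i j k) := rfl

theorem flipItems_flipItems {d : ℕ} (π : Ranking d) (i j : Fin d) :
    flipItems (flipItems π i j) i j = π := by
  ext k; simp [flipItems_apply]

theorem flipItems_comm {d : ℕ} (π : Ranking d) (i j : Fin d) :
    flipItems π i j = flipItems π j i := by
  simp [flipItems, Equiv.swap_comm]

/-- Swapping two items that are ordered as in the central ranking increases the distance to it. -/
theorem kendallTau_succ_le_flipItems {d : ℕ} {π₀ π : Ranking d} {i j : Fin d}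
    (h₀ : π₀ i < π₀ j) (h : π i < π j) :
    kendallTau π₀ π + 1 ≤ kendallTau π₀ (flipItems π i j) := by
  classical
  rw [kendallTau_eq_card, kendallTau_eq_card]
  set w := Equiv.swap i j with hw
  have hmem : (i, j) ∈ discordantPairs π₀ (flipItems π i j) := by
    rw [mem_discordantPairs]; simp [flipItems_apply, h₀, h]
  rw [← Finset.card_erase_add_one hmem]
  refine Nat.succ_le_succ ?_
  -- The old discordant pairs inject into the new ones other than `(i, j)`: a pair is moved by the
  -- swap if its image keeps the `π₀`-order, and stays put otherwise. A pair that stays put has one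
  -- item in common with `{i, j}`, and the swap makes it no less discordant. The two kinds of image
  -- cannot collide, because applying the swap again recovers a `π₀`-ordered pair only in the first
  -- case.
  refine Finset.card_le_card_of_injOn
    (fun p => if π₀ (w p.1) < π₀ (w p.2) then (w p.1, w p.2) else p) ?_ ?_
  · rintro ⟨x, y⟩ hp
    rw [Finset.mem_coe, mem_discordantPairs] at hp
    rw [Finset.mem_coe, Finset.mem_erase, mem_discordantPairs]
    dsimp only at hp ⊢
    split_ifs with h1
    · refine ⟨fun he => ?_, h1, by simpa [flipItems_apply, hw] using hp.2⟩
      obtain ⟨hx, hy⟩ := Prod.ext_iff.mp he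
      have hx' : x = j := by
        rw [← Equiv.swap_apply_left i j, ← hw, ← show w x = i from hx]; simp [hw]
      have hy' : y = i := by
        rw [← Equiv.swap_apply_right i j, ← hw, ← show w y = j from hy]; simp [hw]
      subst hx' hy'
      exact lt_asymm h₀ hp.1
    · refine ⟨fun he => ?_, hp.1, ?_⟩
      · obtain ⟨rfl, rfl⟩ := Prod.ext_iff.mp he
        exact lt_asymm h hp.2
      · simp only [flipItems_apply]
        rw [← hw]
        simp only [hw, Equiv.swap_apply_def] at h1 ⊢
        split_ifs at h1 ⊢ <;> subst_vars <;> simp_all <;> order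
  · rintro ⟨x, y⟩ hp ⟨x', y'⟩ hp' he
    rw [Finset.mem_coe, mem_discordantPairs] at hp hp'
    dsimp only at hp hp' he
    split_ifs at he with h1 h2 h2
    · simpa using he
    · obtain ⟨rfl, rfl⟩ := Prod.ext_iff.mp he
      simp only [hw, Equiv.swap_apply_self] at h2
      exact absurd hp.1 h2
    · obtain ⟨rfl, rfl⟩ := Prod.ext_iff.mp he
      simp only [hw, Equiv.swap_apply_self] at h1
      exact absurd hp'.1 h1
    · exact he

/-- Swapping two neighboring items increases the distance to the central ranking by one. -/
theorem kendallTau_flipItems_of_adjacent {d : ℕ} {π₀ π : Ranking d} {i j : Fin d}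
    (h₀ : (π₀ j : ℕ) = π₀ i + 1) (h : π i < π j) :
    kendallTau π₀ (flipItems π i j) = kendallTau π₀ π + 1 := by
  classical
  have h₀' : π₀ i < π₀ j := by rw [Fin.lt_def]; omega
  refine le_antisymm ?_ (kendallTau_succ_le_flipItems h₀' h)
  rw [kendallTau_eq_card, kendallTau_eq_card]
  set w := Equiv.swap i j with hw
  have hmem : (i, j) ∈ discordantPairs π₀ (flipItems π i j) := by
    rw [mem_discordantPairs]; simp [flipItems_apply, h₀', h]
  rw [← Finset.card_erase_add_one hmem]
  refine Nat.succ_le_succ ?_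
  -- No item lies between `i` and `j` in `π₀`, so the swap keeps the `π₀`-order of every pair except
  -- `(i, j)` and maps the remaining discordant pairs back to old ones.
  refine Finset.card_le_card_of_injOn (fun p => (w p.1, w p.2)) ?_ ?_
  · rintro ⟨x, y⟩ hp
    rw [Finset.mem_coe, Finset.mem_erase, mem_discordantPairs] at hp
    rw [Finset.mem_coe, mem_discordantPairs]
    dsimp only at hp ⊢
    obtain ⟨hne, hxy, hp⟩ := hp
    refine ⟨?_, hp⟩
    have inj : ∀ a b : Fin d, (π₀ a : ℕ) = π₀ b → a = b := fun a b hab =>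
      π₀.injective (Fin.ext hab)
    rw [Fin.lt_def] at hxy ⊢
    have h1 := inj x i
    have h2 := inj x j
    have h3 := inj y i
    have h4 := inj y j
    simp only [hw, Equiv.swap_apply_def]
    have hne' : ¬(x = i ∧ y = j) := fun hc => hne (Prod.ext hc.1 hc.2)
    split_ifs <;> grind
  · rintro ⟨x, y⟩ _ ⟨x', y'⟩ _ he
    simpa using he

/-- Relabeling the items by `π₀` moves the center to the identity; hence the normalizing constant
does not depend on the center. -/
theorem kendallTau_mul_right {d : ℕ} (π₀ ρ : Ranking d) :
    kendallTau π₀ (ρ * π₀) = kendallTau 1 ρ := by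
  rw [kendallTau_eq_card, kendallTau_eq_card]
  refine Finset.card_equiv (Equiv.prodCongr π₀ π₀) fun p => ?_
  simp [mem_discordantPairs]

/-- Inserting a new first item at position `p` creates `p` inversions. -/
theorem kendallTau_insert_zero {n : ℕ} (p : Fin (n + 1)) (e : Ranking n) :
    kendallTau 1 (p.cycleRange.symm * Equiv.Perm.decomposeFin.symm (0, e)) =
      p + kendallTau 1 e := by
  rw [kendallTau_eq_card, kendallTau_eq_card]
  -- The item `0` goes to position `p`, the others fill the remaining positions in the order of `e`;
  -- exactly `p` of them end up ahead of item `0`.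
  set σ : Ranking (n + 1) := p.cycleRange.symm * Equiv.Perm.decomposeFin.symm (0, e) with hσ
  have h0 : σ 0 = p := by simp [hσ]
  have hs : ∀ x : Fin n, σ x.succ = p.succAbove (e x) := fun x => by
    simp [hσ, Equiv.Perm.decomposeFin_symm_apply_succ]
  have hp : (Finset.univ.filter fun x : Fin n => p.succAbove (e x) < p).card = p := by
    have : (Finset.univ.filter fun x : Fin n => p.succAbove (e x) < p).card =
        (Finset.univ.filter fun x : Fin n => (x : ℕ) < p).card := by
      refine Finset.card_equiv e fun x => ?_
      simp only [Finset.mem_filter, Finset.mem_univ, true_and, Fin.succAbove_lt_iff_castSucc_lt]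
      rfl
    rw [this, Fin.card_filter_val_lt]
    omega
  have hD : ∀ {m : ℕ} (τ : Ranking m), (discordantPairs 1 τ).card =
      ∑ x, ∑ y, if x < y ∧ τ y < τ x then 1 else 0 := fun τ => by
    rw [discordantPairs, Finset.card_filter, Fintype.sum_prod_type]
    rfl
  rw [Finset.card_filter] at hp
  rw [hD, hD]
  rw [Fin.sum_univ_succ, Fin.sum_univ_succ]
  simp only [Fin.sum_univ_succ (n := n), h0, hs, Fin.succ_lt_succ_iff, Fin.succAbove_lt_succAbove_iff,
    Fin.succ_pos, true_and, hp, Fin.not_lt_zero, false_and, if_false, zero_add, lt_irrefl]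

/-- The product formula for the normalizing constant of the Mallows distribution. -/
theorem sum_pow_kendallTau {d : ℕ} (π₀ : Ranking d) (x : ℝ) :
    ∑ σ : Ranking d, x ^ kendallTau π₀ σ =
      ∏ i ∈ Finset.range d, ∑ k ∈ Finset.range (i + 1), x ^ k := by
  have h1 : ∑ σ : Ranking d, x ^ kendallTau π₀ σ = ∑ ρ : Ranking d, x ^ kendallTau 1 ρ := by
    rw [← Equiv.sum_comp (Equiv.mulRight π₀)]
    simp [kendallTau_mul_right]
  rw [h1]
  clear h1 π₀
  induction d with
  | zero => simp [kendallTau_eq_card, discordantPairs]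
  | succ n ih =>
    -- Every ranking arises from exactly one insertion, so the new item contributes the independent
    -- factor `1 + x + ⋯ + x ^ n`.
    let E : Fin (n + 1) × Ranking n ≃ Ranking (n + 1) :=
      Equiv.ofBijective
        (fun q => q.1.cycleRange.symm * Equiv.Perm.decomposeFin.symm (0, q.2)) <| by
        rw [Fintype.bijective_iff_injective_and_card]
        constructor
        · rintro ⟨p, e⟩ ⟨p', e'⟩ h
          dsimp only at h
          have h0 := congrArg (fun σ : Ranking (n + 1) => σ 0) h
          simp at h0
          subst h0
          simpa using h
        · rw [← Fintype.card_congr (Equiv.Perm.decomposeFin (n := n))]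
    rw [← Equiv.sum_comp E, Fintype.sum_prod_type]
    simp only [E, Equiv.ofBijective_apply, kendallTau_insert_zero, pow_add]
    simp_rw [← Finset.mul_sum]
    rw [ih, ← Finset.sum_mul, Finset.prod_range_succ, mul_comm, Finset.sum_range (n := n + 1)]

/-! ### Total variation distance of Mallows laws with a common center. -/

section TotalVariation

/-- The total variation distance is bounded by the Hellinger affinity. -/
theorem tvDist_sq_le {X : Type*} [Fintype X] (P Q : PMF X) :
    tvDist P Q ^ 2 ≤ 1 - (∑ x, √((P x).toReal * (Q x).toReal)) ^ 2 := by
  have hsum : ∀ R : PMF X, ∑ x, (R x).toReal = 1 := fun R => by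
    rw [← ENNReal.toReal_sum fun x _ => R.apply_ne_top x, ← tsum_fintype (L := .unconditional _),
      R.tsum_coe, ENNReal.toReal_one]
  set p : X → ℝ := fun x => √(P x).toReal
  set q : X → ℝ := fun x => √(Q x).toReal
  have hp : ∀ x, p x ^ 2 = (P x).toReal := fun x => Real.sq_sqrt ENNReal.toReal_nonneg
  have hq : ∀ x, q x ^ 2 = (Q x).toReal := fun x => Real.sq_sqrt ENNReal.toReal_nonneg
  have hp0 : ∀ x, 0 ≤ p x := fun x => Real.sqrt_nonneg _
  have hq0 : ∀ x, 0 ≤ q x := fun x => Real.sqrt_nonneg _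
  have hpq : ∀ x, √((P x).toReal * (Q x).toReal) = p x * q x := fun x =>
    Real.sqrt_mul ENNReal.toReal_nonneg _
  simp_rw [hpq]
  -- Factoring the difference through square roots and applying Cauchy–Schwarz leaves sums of
  -- squares that are `2 - 2 A` and `2 + 2 A` for the affinity `A`.
  have h1 : ∑ x, |(P x).toReal - (Q x).toReal| = ∑ x, |p x - q x| * (p x + q x) := by
    refine Finset.sum_congr rfl fun x _ => ?_
    rw [← hp, ← hq, sq_sub_sq, abs_mul, abs_of_nonneg (add_nonneg (hp0 x) (hq0 x)), mul_comm]
  have h2 := Finset.sum_mul_sq_le_sq_mul_sq Finset.univ (fun x => |p x - q x|)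
    (fun x => p x + q x)
  have h3 : ∑ x, |p x - q x| ^ 2 = 2 - 2 * ∑ x, p x * q x := by
    simp_rw [sq_abs, sub_sq, hp, hq]
    rw [Finset.sum_add_distrib, Finset.sum_sub_distrib, hsum, hsum, Finset.mul_sum]
    simp_rw [mul_assoc]
    ring
  have h4 : ∑ x, (p x + q x) ^ 2 = 2 + 2 * ∑ x, p x * q x := by
    simp_rw [add_sq, hp, hq]
    rw [Finset.sum_add_distrib, Finset.sum_add_distrib, hsum, hsum, Finset.mul_sum]
    simp_rw [mul_assoc]
    ring
  rw [h3, h4] at h2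
  rw [tvDist, h1, mul_pow]
  linarith

theorem tvDist_le_one {X : Type*} [Fintype X] (P Q : PMF X) : tvDist P Q ≤ 1 := by
  have h := tvDist_sq_le P Q
  have := sq_nonneg (∑ x, √((P x).toReal * (Q x).toReal))
  nlinarith

theorem mallows_apply_toReal {d : ℕ} (π₀ : Ranking d) (φ : unitInterval) (π : Ranking d) :
    (mallows π₀ φ π).toReal = (φ : ℝ) ^ kendallTau π₀ π / ∑ σ, (φ : ℝ) ^ kendallTau π₀ σ := by
  have hnn : ∀ σ : Ranking d, 0 ≤ (φ : ℝ) ^ kendallTau π₀ σ := fun σ => pow_nonneg φ.2.1 _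
  rw [mallows, PMF.normalize_apply, tsum_fintype]
  simp only [mallowsWeight]
  rw [← ENNReal.ofReal_sum_of_nonneg fun σ _ => hnn σ, ENNReal.toReal_mul, ENNReal.toReal_inv,
    ENNReal.toReal_ofReal (hnn π), ENNReal.toReal_ofReal (Finset.sum_nonneg fun σ _ => hnn σ),
    div_eq_mul_inv]

theorem one_sub_mul_le_prod {n : ℕ} {x : ℕ → ℝ} {c : ℝ} (h0 : ∀ i, 0 ≤ x i) (h1 : ∀ i, x i ≤ 1)
    (hc0 : 0 ≤ c) (hc : ∀ i, 1 - c ≤ x i) : 1 - n * c ≤ ∏ i ∈ Finset.range n, x i := by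
  induction n with
  | zero => simp
  | succ n ih =>
    have hp0 : 0 ≤ ∏ i ∈ Finset.range n, x i := Finset.prod_nonneg fun i _ => h0 i
    have hp1 : ∏ i ∈ Finset.range n, x i ≤ 1 :=
      Finset.prod_le_one (fun i _ => h0 i) fun i _ => h1 i
    rw [Finset.prod_range_succ]
    push_cast
    nlinarith [mul_le_mul_of_nonneg_left (hc n) hp0, mul_le_mul_of_nonneg_right hp1 hc0]

/-- The right side is the squared Hellinger affinity of two truncated geometric laws. Writing `U`,
`V` for the sums in the denominator and `W` for the mixed sum, the subtracted sum is `U + V - 2 W`;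
since `U, V ≥ 1`, the claim reduces to `(U - W) ^ 2 ≥ 0`. -/
theorem one_sub_le_sq_sum_mul_div (n : ℕ) (a b : ℝ) :
    1 - ∑ k ∈ Finset.range (n + 1), (a ^ k - b ^ k) ^ 2 ≤
      (∑ k ∈ Finset.range (n + 1), (a * b) ^ k) ^ 2 /
        ((∑ k ∈ Finset.range (n + 1), (a ^ 2) ^ k) *
          ∑ k ∈ Finset.range (n + 1), (b ^ 2) ^ k) := by
  have hone : ∀ c : ℝ, 1 ≤ ∑ k ∈ Finset.range (n + 1), (c ^ 2) ^ k := fun c => by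
    rw [Finset.sum_range_succ']
    have : 0 ≤ ∑ k ∈ Finset.range n, (c ^ 2) ^ (k + 1) :=
      Finset.sum_nonneg fun k _ => pow_nonneg (sq_nonneg c) _
    simpa using this
  have hs : ∑ k ∈ Finset.range (n + 1), (a ^ k - b ^ k) ^ 2 =
      (∑ k ∈ Finset.range (n + 1), (a ^ 2) ^ k) + (∑ k ∈ Finset.range (n + 1), (b ^ 2) ^ k) -
        2 * ∑ k ∈ Finset.range (n + 1), (a * b) ^ k := by
    rw [Finset.mul_sum, ← Finset.sum_add_distrib, ← Finset.sum_sub_distrib]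
    refine Finset.sum_congr rfl fun k _ => ?_
    rw [mul_pow, ← pow_mul, ← pow_mul]
    ring
  rw [hs]
  have hU := hone a
  have hV := hone b
  have hS : 0 ≤ ∑ k ∈ Finset.range (n + 1), (a ^ k - b ^ k) ^ 2 :=
    Finset.sum_nonneg fun k _ => sq_nonneg _
  rw [hs] at hS
  generalize ∑ k ∈ Finset.range (n + 1), (a ^ 2) ^ k = U at *
  generalize ∑ k ∈ Finset.range (n + 1), (b ^ 2) ^ k = V at *
  generalize ∑ k ∈ Finset.range (n + 1), (a * b) ^ k = W at *
  rw [le_div_iff₀ (by positivity)]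
  have h1 : 0 ≤ (V - 1) * (U * (U + V - 2 * W)) :=
    mul_nonneg (by linarith) (mul_nonneg (by linarith) hS)
  nlinarith [sq_nonneg (U - W)]

/-- The `k`-th term is at most `k ^ 2 * r ^ (2 k - 2) * (a - b) ^ 2`, and this series converges for
`r < 1`. It is the source of the dependence of the final constant on `γ`, and of its independence of
`d`. -/
theorem exists_sum_sq_pow_sub_pow_le {r : ℝ} (hr0 : 0 < r) (hr1 : r < 1) :
    ∃ K : ℝ, 1 ≤ K ∧ ∀ (n : ℕ) (a b : ℝ), 0 ≤ a → a ≤ r → 0 ≤ b → b ≤ r →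
      ∑ k ∈ Finset.range n, (a ^ k - b ^ k) ^ 2 ≤ K * (a - b) ^ 2 := by
  have hsm : Summable fun k : ℕ => (k : ℝ) ^ 2 * (r ^ 2) ^ k :=
    summable_pow_mul_geometric_of_norm_lt_one 2 (by
      rw [Real.norm_of_nonneg (sq_nonneg r)]; nlinarith)
  have hT0 : 0 ≤ ∑' k : ℕ, (k : ℝ) ^ 2 * (r ^ 2) ^ k := tsum_nonneg fun k => by positivity
  refine ⟨1 + (∑' k : ℕ, (k : ℝ) ^ 2 * (r ^ 2) ^ k) / r ^ 2, ?_, ?_⟩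
  · have := div_nonneg hT0 (sq_nonneg r)
    linarith
  · intro n a b ha har hb hbr
    have hterm : ∀ k : ℕ, (a ^ k - b ^ k) ^ 2 ≤
        (a - b) ^ 2 / r ^ 2 * ((k : ℝ) ^ 2 * (r ^ 2) ^ k) := fun k => by
      cases k with
      | zero => simp
      | succ k =>
        have h1 := abs_pow_sub_pow_le a b (k + 1)
        have hm : max |a| |b| ≤ r := by
          rw [abs_of_nonneg ha, abs_of_nonneg hb]; exact max_le har hbr
        have h2 : |a ^ (k + 1) - b ^ (k + 1)| ≤ |a - b| * (k + 1 : ℕ) * r ^ k := by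
          refine h1.trans ?_
          rw [Nat.add_sub_cancel]
          gcongr
        have h3 := pow_le_pow_left₀ (abs_nonneg _) h2 2
        rw [sq_abs] at h3
        refine h3.trans (le_of_eq ?_)
        rw [mul_pow, mul_pow, sq_abs, ← pow_mul, ← pow_mul]
        field_simp
        ring
    calc _ ≤ ∑ k ∈ Finset.range n, (a - b) ^ 2 / r ^ 2 * ((k : ℝ) ^ 2 * (r ^ 2) ^ k) :=
          Finset.sum_le_sum fun k _ => hterm k
      _ = (a - b) ^ 2 / r ^ 2 * ∑ k ∈ Finset.range n, ((k : ℝ) ^ 2 * (r ^ 2) ^ k) := by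
          rw [Finset.mul_sum]
      _ ≤ (a - b) ^ 2 / r ^ 2 * ∑' k : ℕ, (k : ℝ) ^ 2 * (r ^ 2) ^ k := by
          gcongr
          exact hsm.sum_le_tsum _ fun k _ => by positivity
      _ ≤ _ := by
          have : (a - b) ^ 2 / r ^ 2 * (∑' k : ℕ, (k : ℝ) ^ 2 * (r ^ 2) ^ k) =
            (∑' k : ℕ, (k : ℝ) ^ 2 * (r ^ 2) ^ k) / r ^ 2 * (a - b) ^ 2 := by ring
          rw [this, add_mul]
          nlinarith [sq_nonneg (a - b)]

/-- The Mallows distributions with a common center are Lipschitz in the square root of the spread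
parameter, away from the uniform distribution. -/
theorem exists_tvDist_mallows_le {γ : ℝ} (hγ : 0 < γ) :
    ∃ K : ℝ, 1 ≤ K ∧ ∀ (d : ℕ) (π₀ : Ranking d) (φ ψ : unitInterval), (φ : ℝ) ≤ 1 - γ →
      (ψ : ℝ) ≤ 1 - γ →
      tvDist (mallows π₀ φ) (mallows π₀ ψ) ≤ K * √d * |√(φ : ℝ) - √(ψ : ℝ)| := by
  -- The maximum with `1 / 2` keeps `r` positive when `γ ≥ 1`.
  set r : ℝ := √(max (1 - γ) (1 / 2)) with hr
  have hr0 : 0 < r := Real.sqrt_pos.mpr (lt_max_of_lt_right (by norm_num))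
  have hr1 : r < 1 := by
    rw [hr, Real.sqrt_lt' one_pos]
    exact max_lt (by linarith) (by norm_num)
  obtain ⟨K, hK1, hK⟩ := exists_sum_sq_pow_sub_pow_le hr0 hr1
  refine ⟨√K, Real.one_le_sqrt.mpr hK1, fun d π₀ φ ψ hφ hψ => ?_⟩
  set a := √(φ : ℝ) with ha
  set b := √(ψ : ℝ) with hb
  have ha2 : a ^ 2 = φ := Real.sq_sqrt φ.2.1
  have hb2 : b ^ 2 = ψ := Real.sq_sqrt ψ.2.1
  have ha0 : 0 ≤ a := Real.sqrt_nonneg _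
  have hb0 : 0 ≤ b := Real.sqrt_nonneg _
  have har : a ≤ r := Real.sqrt_le_sqrt (hφ.trans (le_max_left _ _))
  have hbr : b ≤ r := Real.sqrt_le_sqrt (hψ.trans (le_max_left _ _))
  have hZ0 : ∀ c : ℝ, 0 ≤ c → 0 < ∑ σ : Ranking d, c ^ kendallTau π₀ σ := fun c hc => by
    refine Finset.sum_pos' (fun σ _ => pow_nonneg hc _) ⟨π₀, Finset.mem_univ _, ?_⟩
    simp [kendallTau_self]
  have hbc : (∑ π, √((mallows π₀ φ π).toReal * (mallows π₀ ψ π).toReal)) ^ 2 =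
      (∑ σ : Ranking d, (a * b) ^ kendallTau π₀ σ) ^ 2 /
        ((∑ σ : Ranking d, (a ^ 2) ^ kendallTau π₀ σ) *
          ∑ σ : Ranking d, (b ^ 2) ^ kendallTau π₀ σ) := by
    have hterm : ∀ π, √((mallows π₀ φ π).toReal * (mallows π₀ ψ π).toReal) =
        (a * b) ^ kendallTau π₀ π / √((∑ σ : Ranking d, (a ^ 2) ^ kendallTau π₀ σ) *
          ∑ σ : Ranking d, (b ^ 2) ^ kendallTau π₀ σ) := fun π => by
      rw [mallows_apply_toReal, mallows_apply_toReal, ← ha2, ← hb2, div_mul_div_comm,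
        Real.sqrt_div (by positivity)]
      congr 1
      rw [← mul_pow, ← mul_pow, ← pow_mul, mul_comm 2, pow_mul,
        Real.sqrt_sq (pow_nonneg (mul_nonneg ha0 hb0) _)]
    simp_rw [hterm]
    rw [← Finset.sum_div, div_pow, Real.sq_sqrt
      (mul_nonneg (hZ0 _ (sq_nonneg a)).le (hZ0 _ (sq_nonneg b)).le)]
  -- By the product formula the squared affinity is a product of `d` ratios, each at most one by
  -- Cauchy–Schwarz and at least `1 - K (a - b) ^ 2`.
  have hprod : 1 - d * (K * (a - b) ^ 2) ≤ (∑ σ : Ranking d, (a * b) ^ kendallTau π₀ σ) ^ 2 /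
        ((∑ σ : Ranking d, (a ^ 2) ^ kendallTau π₀ σ) *
          ∑ σ : Ranking d, (b ^ 2) ^ kendallTau π₀ σ) := by
    rw [sum_pow_kendallTau, sum_pow_kendallTau, sum_pow_kendallTau, ← Finset.prod_pow,
      ← Finset.prod_mul_distrib, ← Finset.prod_div_distrib]
    refine one_sub_mul_le_prod (fun i => by positivity) (fun i => ?_) (by positivity)
      fun i => ?_
    · refine div_le_one_of_le₀ ?_ (by positivity)
      have := Finset.sum_mul_sq_le_sq_mul_sq (Finset.range (i + 1)) (fun k => a ^ k) (fun k => b ^ k)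
      simpa only [← mul_pow, ← pow_mul, mul_comm] using this
    · refine le_trans ?_ (one_sub_le_sq_sum_mul_div i a b)
      linarith [hK (i + 1) a b ha0 har hb0 hbr]
  have htv := tvDist_sq_le (mallows π₀ φ) (mallows π₀ ψ)
  rw [hbc] at htv
  refine le_of_sq_le_sq ?_ (by positivity)
  rw [mul_pow, mul_pow, Real.sq_sqrt (by linarith), Real.sq_sqrt (Nat.cast_nonneg _), sq_abs]
  linarith

end TotalVariation

/-! ### Probabilities of agreement and disagreement on an informative pair. -/

section Masses

variable {d : ℕ}

open Classical in
/-- The mass that `Q` gives to the rankings which prefer `i` to `j` and stay in `S` when `i` and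
`j` are swapped. -/
noncomputable def flipMass (Q : PMF (Ranking d)) (S : Set (Ranking d)) (i j : Fin d) : ℝ :=
  ∑ x, if flipItems x i j ∈ S ∧ x i < x j then (Q x).toReal else 0

theorem flipMass_nonneg (Q : PMF (Ranking d)) (S : Set (Ranking d)) (i j : Fin d) :
    0 ≤ flipMass Q S i j :=
  Finset.sum_nonneg fun x _ => by split_ifs <;> simp

theorem sum_toReal_eq_one (Q : PMF (Ranking d)) : ∑ x, (Q x).toReal = 1 := by
  rw [← ENNReal.toReal_sum fun x _ => Q.apply_ne_top x, ← tsum_fintype (L := .unconditional _),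
    Q.tsum_coe, ENNReal.toReal_one]

theorem flipMass_add_flipMass_le_one (Q : PMF (Ranking d)) (S : Set (Ranking d)) (i j : Fin d) :
    flipMass Q S i j + flipMass Q S j i ≤ 1 := by
  classical
  rw [flipMass, flipMass, ← Finset.sum_add_distrib, ← sum_toReal_eq_one Q]
  refine Finset.sum_le_sum fun x _ => ?_
  have h0 : 0 ≤ (Q x).toReal := ENNReal.toReal_nonneg
  rw [flipItems_comm x j i]
  split_ifs with h1 h2 h2
  · exact absurd h2.2 (lt_asymm h1.2)
  all_goals linarith

theorem le_flipMass_add_flipMass {Q : PMF (Ranking d)} {S : Set (Ranking d)} {α : ℝ}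
    {i j : Fin d} (hij : i ≠ j) (h : IsFatForPair Q S α i j) :
    α ≤ flipMass Q S i j + flipMass Q S j i := by
  classical
  have h1 : Q.toMeasure {π | flipItems π i j ∈ S} =
      ENNReal.ofReal (flipMass Q S i j + flipMass Q S j i) := by
    rw [PMF.toMeasure_apply_fintype, flipMass, flipMass, ← Finset.sum_add_distrib,
      ENNReal.ofReal_sum_of_nonneg]
    · refine Finset.sum_congr rfl fun x _ => ?_
      rw [flipItems_comm x j i, Set.indicator_apply]
      have hx : x i ≠ x j := fun he => hij (x.injective he)
      by_cases hf : flipItems x i j ∈ S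
      · rcases lt_or_gt_of_ne hx with hlt | hlt
        · simp [hf, hlt, lt_asymm hlt, ENNReal.ofReal_toReal (Q.apply_ne_top x)]
        · simp [hf, hlt, lt_asymm hlt, ENNReal.ofReal_toReal (Q.apply_ne_top x)]
      · simp [hf]
    · intro x _
      have h0 : 0 ≤ (Q x).toReal := ENNReal.toReal_nonneg
      split_ifs <;> linarith
  rw [IsFatForPair, h1] at h
  exact (ENNReal.ofReal_le_ofReal_iff
    (add_nonneg (flipMass_nonneg _ _ _ _) (flipMass_nonneg _ _ _ _))).mp h

/-- The normalizing constant is left anonymous because only ratios of probabilities matter later. -/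
theorem truncatedMallows_toReal_of_mem (π₀ : Ranking d) (φ : unitInterval)
    (S : Set (Ranking d)) (hS : ∃ π ∈ S, π ∈ (mallows π₀ φ).support) :
    ∃ c : ℝ, 0 ≤ c ∧ ∀ x, (x ∈ S → (truncatedMallows π₀ φ S hS x).toReal =
        c * (φ : ℝ) ^ kendallTau π₀ x) ∧
      (x ∉ S → (truncatedMallows π₀ φ S hS x).toReal = 0) := by
  refine ⟨(∑' x, (S.indicator (mallows π₀ φ)) x)⁻¹.toReal /
    ∑ σ, (φ : ℝ) ^ kendallTau π₀ σ, div_nonneg ENNReal.toReal_nonneg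
      (Finset.sum_nonneg fun σ _ => pow_nonneg φ.2.1 _), fun x => ⟨fun hx => ?_, fun hx => ?_⟩⟩
  · rw [truncatedMallows, PMF.filter_apply, Set.indicator_of_mem hx, ENNReal.toReal_mul,
      mallows_apply_toReal]
    ring
  · rw [truncatedMallows, PMF.filter_apply, Set.indicator_of_notMem hx, zero_mul,
      ENNReal.toReal_zero]

-- Reindexing by the swap turns both masses of a pair into sums over the rankings with `x i < x j`,
-- so they can be compared term by term.
open Classical in
theorem flipMass_swap_eq_sum (Q : PMF (Ranking d)) (S : Set (Ranking d)) (i j : Fin d) :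
    flipMass Q S j i = ∑ x, if x ∈ S ∧ x i < x j then (Q (flipItems x i j)).toReal else 0 := by
  rw [flipMass, ← Equiv.sum_comp (Equiv.mulRight (Equiv.swap i j))]
  refine Finset.sum_congr rfl fun x _ => ?_
  change (if flipItems (flipItems x i j) j i ∈ S ∧ flipItems x i j j < flipItems x i j i
    then (Q (flipItems x i j)).toReal else 0) = _
  rw [flipItems_comm _ j i, flipItems_flipItems]
  simp only [flipItems_apply, Equiv.swap_apply_left, Equiv.swap_apply_right]

/-- Rankings that disagree with the central ranking about a pair are less likely. -/
theorem flipMass_swap_le {π₀ : Ranking d} {φ : unitInterval} {S : Set (Ranking d)}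
    (hS : ∃ π ∈ S, π ∈ (mallows π₀ φ).support) {i j : Fin d} (h : π₀ i < π₀ j) :
    flipMass (truncatedMallows π₀ φ S hS) S j i ≤
      φ * flipMass (truncatedMallows π₀ φ S hS) S i j := by
  classical
  obtain ⟨c, hc, hQ⟩ := truncatedMallows_toReal_of_mem π₀ φ S hS
  rw [flipMass_swap_eq_sum, flipMass, Finset.mul_sum]
  refine Finset.sum_le_sum fun x _ => ?_
  by_cases hx : x i < x j
  · by_cases hxS : x ∈ S
    · by_cases hf : flipItems x i j ∈ S
      · simp only [hx, hxS, hf, and_self, if_true, (hQ x).1 hxS, (hQ _).1 hf]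
        calc c * (φ : ℝ) ^ kendallTau π₀ (flipItems x i j) ≤
            c * (φ : ℝ) ^ (kendallTau π₀ x + 1) := by
              gcongr ?_ * ?_
              exact pow_le_pow_of_le_one φ.2.1 φ.2.2 (kendallTau_succ_le_flipItems h hx)
          _ = _ := by ring
      · simp [hf, (hQ _).2 hf]
    · simp only [hxS, false_and, if_false]
      exact mul_nonneg φ.2.1 (by split_ifs <;> simp)
  · simp [hx]

/-- For neighboring items, the odds of a disagreement with the central ranking are `φ`. -/
theorem flipMass_swap_eq {π₀ : Ranking d} {φ : unitInterval} {S : Set (Ranking d)}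
    (hS : ∃ π ∈ S, π ∈ (mallows π₀ φ).support) {i j : Fin d} (h : (π₀ j : ℕ) = π₀ i + 1) :
    flipMass (truncatedMallows π₀ φ S hS) S j i =
      φ * flipMass (truncatedMallows π₀ φ S hS) S i j := by
  classical
  obtain ⟨c, hc, hQ⟩ := truncatedMallows_toReal_of_mem π₀ φ S hS
  rw [flipMass_swap_eq_sum, flipMass, Finset.mul_sum]
  refine Finset.sum_congr rfl fun x _ => ?_
  by_cases hx : x i < x j
  · by_cases hxS : x ∈ S
    · by_cases hf : flipItems x i j ∈ S
      · simp only [hx, hxS, hf, and_self, if_true, (hQ x).1 hxS, (hQ _).1 hf,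
          kendallTau_flipItems_of_adjacent h hx]
        ring
      · simp [hf, (hQ _).2 hf]
    · simp [hxS, (hQ _).2 hxS]
  · simp [hx]

/-- The exponential moment of a function of the order of the pair `i`, `j` that vanishes on the
rankings that leave `S` when the pair is swapped. -/
theorem lintegral_exp_le (Q : PMF (Ranking d)) (S : Set (Ranking d)) {i j : Fin d} (hij : i ≠ j)
    {f : Ranking d → ℝ} {a b r : ℝ}
    (ha : ∀ x, flipItems x i j ∈ S → x i < x j → f x = a)
    (hb : ∀ x, flipItems x i j ∈ S → x j < x i → f x = b)
    (h0 : ∀ x, flipItems x i j ∉ S → f x = 0)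
    (hr : 1 + flipMass Q S i j * (Real.exp a - 1) + flipMass Q S j i * (Real.exp b - 1) ≤ r) :
    ∫⁻ x, ENNReal.ofReal (Real.exp (f x)) ∂Q.toMeasure ≤ ENNReal.ofReal r := by
  classical
  have hterm : ∀ x, ENNReal.ofReal (Real.exp (f x)) * Q.toMeasure {x} =
      ENNReal.ofReal ((Q x).toReal * Real.exp (f x)) := fun x => by
    rw [PMF.toMeasure_apply_singleton _ _ (MeasurableSet.singleton x), mul_comm,
      ENNReal.ofReal_mul ENNReal.toReal_nonneg, ENNReal.ofReal_toReal (Q.apply_ne_top x)]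
  rw [lintegral_fintype]
  simp_rw [hterm]
  rw [← ENNReal.ofReal_sum_of_nonneg fun x _ => by positivity]
  refine ENNReal.ofReal_le_ofReal (le_trans (le_of_eq ?_) hr)
  suffices h : ∑ x, (Q x).toReal * Real.exp (f x) = ∑ x, (Q x).toReal +
      flipMass Q S i j * (Real.exp a - 1) + flipMass Q S j i * (Real.exp b - 1) by
    rw [h, sum_toReal_eq_one]
  rw [flipMass, flipMass, Finset.sum_mul, Finset.sum_mul,
    ← Finset.sum_add_distrib, ← Finset.sum_add_distrib]
  refine Finset.sum_congr rfl fun x _ => ?_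
  rw [flipItems_comm x j i]
  have hx : x i ≠ x j := fun he => hij (x.injective he)
  by_cases hf : flipItems x i j ∈ S
  · rcases lt_or_gt_of_ne hx with hlt | hlt
    · simp only [hf, hlt, lt_asymm hlt, and_true, and_false, if_true, if_false, ha x hf hlt]
      ring
    · simp only [hf, hlt, lt_asymm hlt, and_true, and_false, if_true, if_false, hb x hf hlt]
      ring
  · simp [hf, h0 x hf]

end Masses

/-! ### A generic learner that waits until a candidate is accepted. -/

section SearchLearner

/-- The law of a coin that shows `1` with probability `q` and `0` otherwise. -/
noncomputable def coinLaw (q : ℝ) (h0 : 0 ≤ q) (h1 : q ≤ 1) : PMF ℕ :=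
  PMF.ofFinset (fun u => if u = 0 then ENNReal.ofReal (1 - q)
    else if u = 1 then ENNReal.ofReal q else 0) {0, 1}
    (by
      rw [Finset.sum_pair zero_ne_one, if_pos rfl, if_neg one_ne_zero, if_pos rfl,
        ← ENNReal.ofReal_add (by linarith) h0, sub_add_cancel, ENNReal.ofReal_one])
    (fun u hu => by
      simp only [Finset.mem_insert, Finset.mem_singleton, not_or] at hu
      rw [if_neg hu.1, if_neg hu.2])

theorem coinLaw_toMeasure_ne_zero (q : ℝ) (h0 : 0 ≤ q) (h1 : q ≤ 1) :
    (coinLaw q h0 h1).toMeasure {u | u ≠ 0} = ENNReal.ofReal q := by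
  rw [PMF.toMeasure_apply _ (.of_discrete), tsum_eq_single 1]
  · simp [coinLaw, PMF.ofFinset_apply]
  · intro u hu
    rw [Set.indicator_apply]
    split_ifs with h
    · have h' : u ≠ 0 := h
      simp [coinLaw, PMF.ofFinset_apply, hu, h']
    · rfl

variable {X Cand Out : Type*}

open Classical in
/-- The learner that does nothing with probability `1 - q`, and otherwise draws samples until some
candidate is accepted by the rule `R`. -/
noncomputable def searchLearner (q : ℝ) (h0 : 0 ≤ q) (h1 : q ≤ 1)
    (R : Set X → List X → Cand → Prop) (out : Set X → List X → Cand → Out) (o : Out) :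
    Learner X Out where
  coins := coinLaw q h0 h1
  act u S l := if u = 0 then some o else
    if h : ∃ c, R S l c then some (out S l h.choose) else none

-- A stopping time is the number of times at which the process has not stopped yet; this turns an
-- expected sample count into a sum of probabilities.
open Classical in
theorem iInf_halted_le_tsum (halted : ℕ → Prop) :
    (⨅ (n : ℕ) (_ : halted n), (n : ℝ≥0∞)) ≤ ∑' n : ℕ, if halted n then 0 else 1 := by
  by_cases h : ∃ n, halted n
  · refine (iInf₂_le (Nat.find h) (Nat.find_spec h)).trans ?_
    calc ((Nat.find h : ℕ) : ℝ≥0∞) = ∑ n ∈ Finset.range (Nat.find h), 1 := by simp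
      _ = ∑ n ∈ Finset.range (Nat.find h), if halted n then (0 : ℝ≥0∞) else 1 :=
          Finset.sum_congr rfl fun n hn => by
            rw [if_neg (Nat.find_min h (Finset.mem_range.mp hn))]
      _ ≤ _ := ENNReal.sum_le_tsum _
  · push Not at h
    simp [h]

variable [MeasurableSpace X] [Finite X] [DiscreteMeasurableSpace X]

/-- Correctness needs a bound, uniform over times and candidates, on ever accepting a bad output.
Speed needs only one candidate `c₀`: the learner has stopped once `c₀` is accepted. Giving up at
once costs no samples, so the waiting time is multiplied by `q`, and a success in that branch is not
counted. -/
theorem searchLearner_spec {q : ℝ} (h0 : 0 ≤ q) (h1 : q ≤ 1)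
    (R : Set X → List X → Cand → Prop) (out : Set X → List X → Cand → Out) (o : Out)
    (S : Set X) (Q : PMF X) (good : Out → Prop) (c₀ : Cand) {η B : ℝ} (hη : 0 ≤ η)
    (hbad : (Measure.infinitePi fun _ : ℕ => Q.toMeasure)
      {ω | ∃ n c, R S ((List.range n).map ω) c ∧ ¬good (out S ((List.range n).map ω) c)} ≤
        ENNReal.ofReal η)
    (hB : ∑' n : ℕ, (Measure.infinitePi fun _ : ℕ => Q.toMeasure)
      {ω | ¬R S ((List.range n).map ω) c₀} ≤ ENNReal.ofReal B) :
    ENNReal.ofReal (q * (1 - η)) ≤ (searchLearner q h0 h1 R out o).successProb S Q good ∧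
      (searchLearner q h0 h1 R out o).expectedSamples S Q ≤ ENNReal.ofReal (q * B) := by
  classical
  set L := searchLearner q h0 h1 R out o with hL
  set ν : Measure (ℕ → X) := Measure.infinitePi fun _ : ℕ => Q.toMeasure with hν
  have hact : ∀ u l, L.act u S l = if u = 0 then some o else
    if h : ∃ c, R S l c then some (out S l h.choose) else none := fun u l => rfl
  have hcoin : L.coins.toMeasure {u | u ≠ 0} = ENNReal.ofReal q :=
    coinLaw_toMeasure_ne_zero q h0 h1
  constructor
  · set bad : Set (ℕ → X) :=
      {ω | ∃ n c, R S ((List.range n).map ω) c ∧ ¬good (out S ((List.range n).map ω) c)}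
      with hbad_def
    set never : Set (ℕ → X) := {ω | ∀ n, ¬∃ c, R S ((List.range n).map ω) c} with hnever_def
    -- Never stopping is contained in every event of the convergent series `hB`, so it has
    -- probability zero.
    have hnever : ν never = 0 := by
      by_contra hne
      have htop : ∑' _ : ℕ, ν never = ⊤ := ENNReal.tsum_const_eq_top_of_ne_zero hne
      have hle : ∑' _ : ℕ, ν never ≤ ENNReal.ofReal B :=
        (ENNReal.tsum_le_tsum fun n =>
          measure_mono fun ω (hω : ∀ m, ¬∃ c, R S ((List.range m).map ω) c) =>
            fun hR => hω n ⟨c₀, hR⟩).trans hB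
      rw [htop] at hle
      exact absurd hle (by simp)
    have hG : ENNReal.ofReal (1 - η) ≤ ν (bad ∪ never)ᶜ := by
      have h2 : (1 : ℝ≥0∞) ≤ ν (bad ∪ never) + ν (bad ∪ never)ᶜ := by
        rw [← measure_univ (μ := ν), ← Set.union_compl_self (bad ∪ never)]
        exact measure_union_le _ _
      have h3 : ν (bad ∪ never) ≤ ENNReal.ofReal η :=
        (measure_union_le _ _).trans (by rw [hnever, add_zero]; exact hbad)
      rw [ENNReal.ofReal_sub _ hη, ENNReal.ofReal_one, tsub_le_iff_left]
      exact h2.trans (by gcongr)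
    calc ENNReal.ofReal (q * (1 - η)) = ENNReal.ofReal q * ENNReal.ofReal (1 - η) :=
          ENNReal.ofReal_mul h0
      _ ≤ L.coins.toMeasure {u | u ≠ 0} * ν (bad ∪ never)ᶜ := by rw [hcoin]; gcongr
      _ = L.runLaw Q ({u | u ≠ 0} ×ˢ (bad ∪ never)ᶜ) := by
          rw [Learner.runLaw, Measure.prod_prod]
      _ ≤ _ := by
          refine measure_mono ?_
          rintro ⟨u, ω⟩ ⟨hu, hω⟩
          have hu' : u ≠ 0 := hu
          rw [Set.mem_compl_iff, Set.mem_union, not_or] at hω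
          obtain ⟨hω1, hω2⟩ := hω
          simp only [hnever_def, Set.mem_ofPred_eq, not_forall, not_not] at hω2
          simp only [hbad_def, Set.mem_ofPred_eq, not_exists, not_and, not_not] at hω1
          have hspec := Nat.find_spec hω2
          refine ⟨out S _ hspec.choose, ⟨Nat.find hω2, ?_, fun m hm => ?_⟩,
            hω1 _ _ hspec.choose_spec⟩
          · rw [hact, if_neg hu', dif_pos hspec]
          · rw [hact, if_neg hu', dif_neg (Nat.find_min hω2 hm)]
  · have hpt : ∀ p : ℕ × (ℕ → X), L.sampleCount S p.1 p.2 ≤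
        ∑' n : ℕ, ({u : ℕ | u ≠ 0} ×ˢ
          {ω : ℕ → X | ¬∃ c, R S ((List.range n).map ω) c}).indicator 1 p := by
      rintro ⟨u, ω⟩
      rw [Learner.sampleCount]
      by_cases hu : u = 0
      · refine (iInf₂_le 0 (by simp [hact, hu])).trans (by simp)
      · refine (iInf_halted_le_tsum _).trans (ENNReal.tsum_le_tsum fun n => ?_)
        by_cases hR : ∃ c, R S ((List.range n).map ω) c
        · have hs : (L.act u S ((List.range n).map ω)).isSome = true := by
            rw [hact, if_neg hu, dif_pos hR]; rfl
          rw [if_pos hs]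
          exact zero_le
        · rw [Set.indicator_of_mem (Set.mk_mem_prod hu hR)]
          split_ifs <;> simp
    have hm : ∀ n : ℕ, MeasurableSet ({u : ℕ | u ≠ 0} ×ˢ
        {ω : ℕ → X | ¬∃ c, R S ((List.range n).map ω) c}) := fun n =>
      MeasurableSet.prod (.of_discrete) (measurableSet_prefix (fun l => ¬∃ c, R S l c) n)
    calc L.expectedSamples S Q ≤ ∫⁻ p, ∑' n : ℕ, ({u : ℕ | u ≠ 0} ×ˢ
          {ω : ℕ → X | ¬∃ c, R S ((List.range n).map ω) c}).indicator 1 p ∂(L.runLaw Q) :=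
          lintegral_mono hpt
      _ = ∑' n : ℕ, ENNReal.ofReal q * ν {ω : ℕ → X | ¬∃ c, R S ((List.range n).map ω) c} := by
          rw [lintegral_tsum fun n => (measurable_one.indicator (hm n)).aemeasurable]
          refine tsum_congr fun n => ?_
          rw [lintegral_indicator_one (hm n), Learner.runLaw, Measure.prod_prod, hcoin]
      _ ≤ ENNReal.ofReal q * ENNReal.ofReal B := by
          rw [ENNReal.tsum_mul_left]
          gcongr
          refine le_trans (ENNReal.tsum_le_tsum fun n => measure_mono
            fun ω (hω : ¬∃ c, R S ((List.range n).map ω) c) => fun hR => hω ⟨c₀, hR⟩) hB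
      _ = ENNReal.ofReal (q * B) := (ENNReal.ofReal_mul h0).symm

end SearchLearner

/-! ### Concentration of the scores and frequencies of one pair. -/

section PairStatistics

variable {d : ℕ}

open Classical in
/-- The vote of a sample for placing `i` before `j`, counted if swapping the pair stays in `S`. -/
noncomputable def flipScore (S : Set (Ranking d)) (i j : Fin d) (x : Ranking d) : ℝ :=
  if flipItems x i j ∈ S then (if x i < x j then 1 else -1) else 0

open Classical in
/-- Whether swapping the pair stays in `S`. -/
noncomputable def flipCount (S : Set (Ranking d)) (i j : Fin d) (x : Ranking d) : ℝ :=
  if flipItems x i j ∈ S then 1 else 0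

open Classical in
/-- Whether swapping the pair stays in `S` and the sample places `j` before `i`. -/
noncomputable def flipDisc (S : Set (Ranking d)) (i j : Fin d) (x : Ranking d) : ℝ :=
  if flipItems x i j ∈ S ∧ x j < x i then 1 else 0

/-- The exponent `γ` matches the odds: `m' * exp γ ≤ m` is exactly what makes the gain `m' * (exp γ
- 1)` from wrong votes no larger than the loss `m * (1 - exp (-γ))` from right ones. Ville's
inequality then covers all times at once. -/
theorem measure_exists_le_score_le {Q : PMF (Ranking d)} {S : Set (Ranking d)} {i j : Fin d}
    (hij : i ≠ j) {γ : ℝ} (hγ : 0 < γ)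
    (hm : flipMass Q S j i * Real.exp γ ≤ flipMass Q S i j) (h : ℝ) :
    (Measure.infinitePi fun _ : ℕ => Q.toMeasure)
      {ω | ∃ n, h ≤ (((List.range n).map ω).map (flipScore S j i)).sum} ≤
        ENNReal.ofReal (Real.exp (-(γ * h))) := by
  have hexp : ∫⁻ x, ENNReal.ofReal (Real.exp (γ * flipScore S j i x)) ∂Q.toMeasure ≤ 1 := by
    rw [← ENNReal.ofReal_one]
    refine lintegral_exp_le Q S hij (a := -γ) (b := γ) (fun x hx hlt => ?_) (fun x hx hlt => ?_)
      (fun x hx => ?_) ?_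
    · simp [flipScore, flipItems_comm x j i, hx, lt_asymm hlt]
    · simp [flipScore, flipItems_comm x j i, hx, hlt]
    · simp [flipScore, flipItems_comm x j i, hx]
    · have hE : 1 ≤ Real.exp γ := Real.one_le_exp hγ.le
      have hinv : Real.exp (-γ) * Real.exp γ = 1 := by rw [← Real.exp_add]; simp
      have hy1 : Real.exp (-γ) ≤ 1 := Real.exp_le_one_iff.mpr (by linarith)
      have h1 := mul_le_mul_of_nonneg_right hm (sub_nonneg.mpr hy1)
      have h2 : flipMass Q S j i * Real.exp γ * (1 - Real.exp (-γ)) =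
          flipMass Q S j i * (Real.exp γ - 1) := by
        rw [mul_sub, mul_one, mul_assoc, mul_comm (Real.exp γ), hinv]; ring
      rw [h2] at h1
      linarith
  refine le_trans (measure_mono ?_) (measure_exists_le_sum_le Q.toMeasure
    (f := fun x => γ * flipScore S j i x) (measurable_of_finite _) hexp (γ * h))
  rintro ω ⟨n, hn⟩
  refine ⟨n, ?_⟩
  rw [sum_map_map_range] at hn
  rw [← Finset.mul_sum]
  gcongr

theorem exp_neg_half_le {γ : ℝ} (hγ : 0 < γ) (hγ1 : γ ≤ 1) :
    Real.exp (-(γ / 2)) ≤ 1 - γ / 4 := by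
  have h1 := Real.add_one_le_exp (γ / 2)
  have h2 : Real.exp (-(γ / 2)) * Real.exp (γ / 2) = 1 := by rw [← Real.exp_add]; simp
  have h3 := Real.exp_pos (-(γ / 2))
  have h4 : Real.exp (-(γ / 2)) * (γ / 2 + 1) ≤ 1 := by
    have := mul_le_mul_of_nonneg_left h1 h3.le
    rwa [h2] at this
  nlinarith

/-- The exponent is half the guaranteed log-odds. With `y = exp (-γ / 2)` the moment falls below one
by at least `m * (1 - y) ^ 2`, where `m ≥ α / 2` as agreement dominates, and `1 - y ≥ γ / 4`; this
gives `α γ ^ 2 / 32`. -/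
theorem measure_score_lt_le {Q : PMF (Ranking d)} {S : Set (Ranking d)} {i j : Fin d}
    (hij : i ≠ j) {γ α : ℝ} (hγ : 0 < γ) (hγ1 : γ ≤ 1)
    (hm : flipMass Q S j i * Real.exp γ ≤ flipMass Q S i j)
    (hα : α ≤ flipMass Q S i j + flipMass Q S j i) (hα1 : α ≤ 1) (h : ℝ) (n : ℕ) :
    (Measure.infinitePi fun _ : ℕ => Q.toMeasure)
      {ω | ¬h ≤ (((List.range n).map ω).map (flipScore S i j)).sum} ≤
        ENNReal.ofReal (Real.exp (γ / 2 * h) * (1 - α * γ ^ 2 / 32) ^ n) := by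
  have hexp : ∫⁻ x, ENNReal.ofReal (Real.exp (-(γ / 2) * flipScore S i j x)) ∂Q.toMeasure ≤
      ENNReal.ofReal (1 - α * γ ^ 2 / 32) := by
    refine lintegral_exp_le Q S hij (a := -(γ / 2)) (b := γ / 2) (fun x hx hlt => ?_)
      (fun x hx hlt => ?_) (fun x hx => ?_) ?_
    · simp [flipScore, hx, hlt]
    · simp [flipScore, hx, lt_asymm hlt]
    · simp [flipScore, hx]
    · have hm0 := flipMass_nonneg Q S i j
      have hm0' := flipMass_nonneg Q S j i
      set m := flipMass Q S i j
      set m' := flipMass Q S j i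
      have hz : Real.exp γ = Real.exp (γ / 2) * Real.exp (γ / 2) := by
        rw [← Real.exp_add]; congr 1; ring
      have hyz : Real.exp (-(γ / 2)) * Real.exp (γ / 2) = 1 := by rw [← Real.exp_add]; simp
      have hy := exp_neg_half_le hγ hγ1
      have hy0 := Real.exp_pos (-(γ / 2))
      have hz1 : 1 ≤ Real.exp (γ / 2) := Real.one_le_exp (by linarith)
      rw [hz] at hm
      generalize Real.exp (-(γ / 2)) = y at *
      generalize Real.exp (γ / 2) = z at *
      have hm1 : m' * z ≤ m * y := by
        calc m' * z = (m' * (z * z)) * y := by linear_combination (-(m' * z)) * hyz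
          _ ≤ m * y := by gcongr
      have hmm : m' ≤ m := by nlinarith
      have h1 : m' * (z - 1) ≤ m * y * (1 - y) := by
        have : m' * (z - 1) = m' * z * (1 - y) := by linear_combination m' * hyz
        rw [this]
        exact mul_le_mul_of_nonneg_right hm1 (by linarith)
      have h2 : α / 2 * (γ / 4) ^ 2 ≤ m * (1 - y) ^ 2 := by
        have h3 : (γ / 4) ^ 2 ≤ (1 - y) ^ 2 := by gcongr; linarith
        calc α / 2 * (γ / 4) ^ 2 ≤ m * (γ / 4) ^ 2 := by gcongr; linarith
          _ ≤ _ := by gcongr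
      nlinarith
  have hr : 0 < 1 - α * γ ^ 2 / 32 := by nlinarith
  have := measure_le_sum_le Q.toMeasure (f := fun x => -(γ / 2) * flipScore S i j x)
    (measurable_of_finite _) hr hexp (-(γ / 2) * h) n
  refine le_trans (measure_mono fun ω hω => ?_) (this.trans (le_of_eq ?_))
  · rw [Set.mem_ofPred_eq, sum_map_map_range, not_le] at hω
    rw [Set.mem_ofPred_eq, ← Finset.mul_sum]
    nlinarith
  · congr 3; ring

theorem measure_count_lt_le {Q : PMF (Ranking d)} {S : Set (Ranking d)} {i j : Fin d}
    (hij : i ≠ j) {α : ℝ}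
    (hα : α ≤ flipMass Q S i j + flipMass Q S j i) (hα1 : α ≤ 1) (M : ℝ) (n : ℕ) :
    (Measure.infinitePi fun _ : ℕ => Q.toMeasure)
      {ω | ¬M ≤ (((List.range n).map ω).map (flipCount S i j)).sum} ≤
        ENNReal.ofReal (Real.exp M * (1 - α / 2) ^ n) := by
  have hexp : ∫⁻ x, ENNReal.ofReal (Real.exp (-flipCount S i j x)) ∂Q.toMeasure ≤
      ENNReal.ofReal (1 - α / 2) := by
    refine lintegral_exp_le Q S hij (a := -1) (b := -1) (fun x hx hlt => ?_)
      (fun x hx hlt => ?_) (fun x hx => ?_) ?_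
    · simp [flipCount, hx]
    · simp [flipCount, hx]
    · simp [flipCount, hx]
    · have h1 : Real.exp (-1) ≤ 1 / 2 := by
        have := Real.exp_neg_one_lt_half
        linarith
      nlinarith [flipMass_nonneg Q S i j, flipMass_nonneg Q S j i]
  have hr : 0 < 1 - α / 2 := by linarith
  have := measure_le_sum_le Q.toMeasure (f := fun x => -flipCount S i j x)
    (measurable_of_finite _) hr hexp (-M) n
  refine le_trans (measure_mono fun ω hω => ?_) (this.trans (le_of_eq ?_))
  · rw [Set.mem_ofPred_eq, sum_map_map_range, not_le] at hω
    rw [Set.mem_ofPred_eq, Finset.sum_neg_distrib]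
    linarith
  · rw [neg_neg]

theorem sq_sub_le_mul_log {u v : ℝ} (hu : 0 < u) (hv : 0 < v) :
    (v - u) ^ 2 ≤ v ^ 2 * Real.log (v / u) - (u * v - u ^ 2) := by
  have h1 := Real.one_sub_inv_le_log_of_pos (div_pos hv hu)
  have h2 : v ^ 2 * (1 - (v / u)⁻¹) ≤ v ^ 2 * Real.log (v / u) := by gcongr
  have h3 : v ^ 2 * (1 - (v / u)⁻¹) = v ^ 2 - u * v := by field_simp
  nlinarith

/-- Ville's inequality for `log (v / u) * b - (u * v - u ^ 2) * a`, with `a` informative samples and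
`b` disagreements among them. The sign condition `huv` makes this an exponential supermartingale.
Once `b / a` is beyond `v ^ 2`, `sq_sub_le_mul_log` shows the process is at least `a * (v - u) ^ 2`.
The factor `v - u` in front treats upper and lower deviations together. -/
theorem measure_exists_ratio_le {Q : PMF (Ranking d)} {S : Set (Ranking d)} {i j : Fin d}
    (hij : i ≠ j) {p u v : ℝ} (hp : flipMass Q S j i =
      p * (flipMass Q S i j + flipMass Q S j i)) (hu : 0 < u) (hv : 0 < v)
    (huv : 0 ≤ (v - u) * (u ^ 2 - p)) {M : ℝ} (hM : 0 ≤ M) :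
    (Measure.infinitePi fun _ : ℕ => Q.toMeasure)
      {ω | ∃ n, M ≤ (((List.range n).map ω).map (flipCount S i j)).sum ∧
        0 ≤ (v - u) * ((((List.range n).map ω).map (flipDisc S i j)).sum -
          (((List.range n).map ω).map (flipCount S i j)).sum * v ^ 2)} ≤
        ENNReal.ofReal (Real.exp (-(M * (v - u) ^ 2))) := by
  set κ := u * v - u ^ 2 with hκ
  have hexp : ∫⁻ x, ENNReal.ofReal (Real.exp
      (Real.log (v / u) * flipDisc S i j x - κ * flipCount S i j x)) ∂Q.toMeasure ≤ 1 := by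
    rw [← ENNReal.ofReal_one]
    refine lintegral_exp_le Q S hij (a := -κ) (b := Real.log (v / u) - κ) (fun x hx hlt => ?_)
      (fun x hx hlt => ?_) (fun x hx => ?_) ?_
    · simp [flipCount, flipDisc, hx, lt_asymm hlt]
    · simp [flipCount, flipDisc, hx, hlt]
    · simp [flipCount, flipDisc, hx]
    · have hm0 := flipMass_nonneg Q S i j
      have hm0' := flipMass_nonneg Q S j i
      set m := flipMass Q S i j
      set m' := flipMass Q S j i
      rw [sub_eq_add_neg (Real.log _), Real.exp_add, Real.exp_log (div_pos hv hu)]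
      have h1 : 1 + p * (v / u - 1) ≤ Real.exp κ := by
        refine le_trans ?_ (Real.add_one_le_exp κ)
        have : κ - p * (v / u - 1) = (v - u) * (u ^ 2 - p) / u := by
          rw [hκ]; field_simp
        have h2 := div_nonneg huv hu.le
        linarith
      have h3 : Real.exp (-κ) * Real.exp κ = 1 := by rw [← Real.exp_add]; simp
      have h4 : Real.exp (-κ) * (m + m' * (v / u)) ≤ m + m' := by
        calc Real.exp (-κ) * (m + m' * (v / u)) =
            Real.exp (-κ) * ((m + m') * (1 + p * (v / u - 1))) := by
              linear_combination (Real.exp (-κ) * (v / u - 1)) * hp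
          _ ≤ Real.exp (-κ) * ((m + m') * Real.exp κ) := by gcongr
          _ = m + m' := by linear_combination (m + m') * h3
      linarith
  refine le_trans (measure_mono ?_) (measure_exists_le_sum_le Q.toMeasure
    (measurable_of_finite _) hexp (M * (v - u) ^ 2))
  rintro ω ⟨n, hn, hn'⟩
  refine ⟨n, ?_⟩
  rw [sum_map_map_range] at hn
  rw [sum_map_map_range, sum_map_map_range] at hn'
  rw [Finset.sum_sub_distrib, ← Finset.mul_sum, ← Finset.mul_sum]
  generalize ∑ k ∈ Finset.range n, flipDisc S i j (ω k) = b at *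
  generalize ∑ k ∈ Finset.range n, flipCount S i j (ω k) = a at *
  have hlog : 0 ≤ Real.log (v / u) * (b - a * v ^ 2) := by
    rcases lt_trichotomy v u with hlt | heq | hgt
    · have h1 : Real.log (v / u) ≤ 0 :=
        Real.log_nonpos (div_pos hv hu).le ((div_le_one hu).mpr hlt.le)
      exact mul_nonneg_of_nonpos_of_nonpos h1 (by nlinarith)
    · simp [heq, hu.ne']
    · have h1 : 0 ≤ Real.log (v / u) := Real.log_nonneg ((one_le_div hu).mpr hgt.le)
      exact mul_nonneg h1 (by nlinarith)
  have h2 := mul_le_mul_of_nonneg_left (sq_sub_le_mul_log hu hv) (hM.trans hn)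
  have h3 : M * (v - u) ^ 2 ≤ a * (v - u) ^ 2 := by gcongr
  rw [hκ]
  linarith

/-- Time-uniform concentration of the empirical frequency, on the scale of square roots. -/
theorem measure_exists_sqrt_ratio_le {Q : PMF (Ranking d)} {S : Set (Ranking d)} {i j : Fin d}
    (hij : i ≠ j) {p t : ℝ} (hp0 : 0 ≤ p) (hp : flipMass Q S j i =
      p * (flipMass Q S i j + flipMass Q S j i)) (ht : 0 < t) {M : ℝ} (hM : 0 < M) :
    (Measure.infinitePi fun _ : ℕ => Q.toMeasure)
      {ω | ∃ n, M ≤ (((List.range n).map ω).map (flipCount S i j)).sum ∧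
        t < |√((((List.range n).map ω).map (flipDisc S i j)).sum /
          (((List.range n).map ω).map (flipCount S i j)).sum) - √p|} ≤
        ENNReal.ofReal (2 * Real.exp (-(M * t ^ 2 / 4))) := by
  have hs0 := Real.sqrt_nonneg p
  have hs2 := Real.sq_sqrt hp0
  have hcond : 0 ≤ (√p + t - (√p + t / 2)) * ((√p + t / 2) ^ 2 - p) := by
    have h1 : (√p + t - (√p + t / 2)) = t / 2 := by ring
    have h2 : (√p + t / 2) ^ 2 - p = √p * t + t ^ 2 / 4 := by linear_combination hs2
    rw [h1, h2]
    positivity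
  -- The base point is `√p + t / 2` and not `√p`, since `p` may vanish while `u` must be positive;
  -- this is what costs the factor `1 / 4` in the exponent.
  have hup := measure_exists_ratio_le hij hp (u := √p + t / 2) (v := √p + t) (by positivity)
    (by positivity) hcond hM.le
  have hlow : (Measure.infinitePi fun _ : ℕ => Q.toMeasure)
      {ω | ∃ n, M ≤ (((List.range n).map ω).map (flipCount S i j)).sum ∧
        √((((List.range n).map ω).map (flipDisc S i j)).sum /
          (((List.range n).map ω).map (flipCount S i j)).sum) < √p - t} ≤
        ENNReal.ofReal (Real.exp (-(M * t ^ 2))) := by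
    -- If `√p ≤ t`, a lower deviation by more than `t` would make a square root negative.
    rcases le_or_gt (√p) t with hle | hlt
    · refine le_trans (le_of_eq ?_) (zero_le)
      convert measure_empty (μ := Measure.infinitePi fun _ : ℕ => Q.toMeasure)
      ext ω
      simp only [Set.mem_ofPred_eq, Set.mem_empty_iff_false, iff_false, not_exists, not_and,
        not_lt]
      exact fun n _ => le_trans (by linarith) (Real.sqrt_nonneg _)
    · have h := measure_exists_ratio_le hij hp (u := √p) (v := √p - t) (by linarith)
        (by linarith) (by rw [hs2]; simp) hM.le
      have he : (√p - t - √p) ^ 2 = t ^ 2 := by ring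
      rw [he] at h
      refine le_trans (measure_mono ?_) h
      rintro ω ⟨n, hn, hn'⟩
      refine ⟨n, hn, ?_⟩
      rw [Real.sqrt_lt' (by linarith), div_lt_iff₀ (hM.trans_le hn)] at hn'
      nlinarith
  have he : (√p + t - (√p + t / 2)) ^ 2 = t ^ 2 / 4 := by ring
  rw [he] at hup
  refine le_trans (measure_mono (t := _ ∪ _) ?_)
    ((measure_union_le _ _).trans ((add_le_add hup hlow).trans ?_))
  · rintro ω ⟨n, hn, hn'⟩
    rcases lt_abs.mp hn' with h | h
    · refine Or.inl ⟨n, hn, ?_⟩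
      have h' := (lt_sub_iff_add_lt'.mp h).le
      rw [Real.le_sqrt' (by positivity), le_div_iff₀ (hM.trans_le hn)] at h'
      exact mul_nonneg (by linarith) (by linarith)
    · exact Or.inr ⟨n, hn, by linarith⟩
  · rw [← ENNReal.ofReal_add (Real.exp_pos _).le (Real.exp_pos _).le]
    refine ENNReal.ofReal_le_ofReal ?_
    have h1 : Real.exp (-(M * t ^ 2)) ≤ Real.exp (-(M * t ^ 2 / 4)) :=
      Real.exp_le_exp.mpr (by nlinarith [mul_pos hM (pow_pos ht 2)])
    have h2 : Real.exp (-(M * (t ^ 2 / 4))) = Real.exp (-(M * t ^ 2 / 4)) := by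
      congr 1; ring
    linarith

end PairStatistics

/-! ### From the frequency of disagreement to the spread parameter. -/

section SpreadEstimate

/-- The spread parameter at which the odds `φ / (1 + φ)` of a disagreement of neighbors are
closest to `y`, capped at `1 - γ`. -/
noncomputable def spreadOfRatio (γ y : ℝ) : unitInterval :=
  Set.projIcc 0 1 zero_le_one (min (min y (1 / 2) / (1 - min y (1 / 2))) (1 - γ))

theorem abs_min_sub_le {x y c : ℝ} (hx : x ≤ c) : |min y c - x| ≤ |y - x| := by
  rcases le_total y c with h | h
  · rw [min_eq_left h]
  · rw [min_eq_right h, abs_of_nonneg (by linarith), abs_of_nonneg (by linarith)]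
    linarith

theorem abs_sqrt_min_sub_le {x y c : ℝ} (hx : x ≤ c) : |√(min y c) - √x| ≤ |√y - √x| := by
  rw [Real.sqrt_monotone.map_min]
  exact abs_min_sub_le (Real.sqrt_le_sqrt hx)

/-- On `[0, 1 / 2]` the map `x / (1 - x)` has Lipschitz constant `4` and does not decrease its
argument. Dividing the difference of odds by the larger sum of square roots transfers the constant
to the root scale, even at zero. -/
theorem abs_sqrt_odds_sub_le {x y : ℝ} (hx0 : 0 ≤ x) (hx : x ≤ 1 / 2) (hy0 : 0 ≤ y)
    (hy : y ≤ 1 / 2) : |√(x / (1 - x)) - √(y / (1 - y))| ≤ 4 * |√x - √y| := by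
  have hodds : ∀ z : ℝ, 0 ≤ z → z ≤ 1 / 2 → z ≤ z / (1 - z) := fun z hz0 hz => by
    rw [le_div_iff₀ (by linarith)]; nlinarith
  have hA := Real.sqrt_nonneg x
  have hB := Real.sqrt_nonneg y
  have hA2 := Real.sq_sqrt hx0
  have hB2 := Real.sq_sqrt hy0
  have hF := Real.sqrt_le_sqrt (hodds x hx0 hx)
  have hG := Real.sqrt_le_sqrt (hodds y hy0 hy)
  have hF2 := Real.sq_sqrt (hx0.trans (hodds x hx0 hx))
  have hG2 := Real.sq_sqrt (hy0.trans (hodds y hy0 hy))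
  have hdiff : |x / (1 - x) - y / (1 - y)| ≤ 4 * |x - y| := by
    have h1 : x / (1 - x) - y / (1 - y) = (x - y) / ((1 - x) * (1 - y)) := by
      have : 1 - x ≠ 0 := by linarith
      have : 1 - y ≠ 0 := by linarith
      field_simp
      ring
    have h2 : 1 / 4 ≤ (1 - x) * (1 - y) := by nlinarith
    rw [h1, abs_div, abs_of_pos (lt_of_lt_of_le (by norm_num) h2),
      div_le_iff₀ (lt_of_lt_of_le (by norm_num) h2)]
    nlinarith [abs_nonneg (x - y)]
  generalize √(x / (1 - x)) = F at *
  generalize √(y / (1 - y)) = G at *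
  generalize √x = A at *
  generalize √y = B at *
  rw [← hF2, ← hG2, ← hA2, ← hB2, sq_sub_sq, sq_sub_sq, abs_mul, abs_mul,
    abs_of_nonneg (by linarith : 0 ≤ F + G), abs_of_nonneg (by linarith : 0 ≤ A + B)] at hdiff
  rcases (by linarith : 0 ≤ F + G).eq_or_lt with h0 | hpos
  · have hF0 : F = 0 := by linarith
    have hG0 : G = 0 := by linarith
    rw [hF0, hG0, sub_self, abs_zero]
    positivity
  · have h3 : (A + B) * |A - B| ≤ (F + G) * |A - B| := by gcongr
    refine le_of_mul_le_mul_left ?_ hpos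
    linarith

/-- The true values satisfy both caps, `1 / 2` for the frequency and `1 - γ` for the spread, so
capping the estimates only moves them closer. -/
theorem spreadOfRatio_spec {γ y : ℝ} {φ : unitInterval} (hγ : 0 < γ) (hφ : (φ : ℝ) ≤ 1 - γ)
    (hy : 0 ≤ y) : ((spreadOfRatio γ y : unitInterval) : ℝ) ≤ 1 - γ ∧
      |√(φ : ℝ) - √(spreadOfRatio γ y : ℝ)| ≤ 4 * |√y - √((φ : ℝ) / (1 + φ))| := by
  have hφ0 : (0 : ℝ) ≤ φ := φ.2.1
  have hy0 : 0 ≤ min y (1 / 2) := le_min hy (by norm_num)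
  have hy1 : min y (1 / 2) ≤ 1 / 2 := min_le_right _ _
  have hr0 : 0 ≤ min y (1 / 2) / (1 - min y (1 / 2)) := div_nonneg hy0 (by linarith)
  have hval : (spreadOfRatio γ y : ℝ) =
      min (min y (1 / 2) / (1 - min y (1 / 2))) (1 - γ) := by
    have hmem : min (min y (1 / 2) / (1 - min y (1 / 2))) (1 - γ) ∈ Set.Icc (0 : ℝ) 1 :=
      ⟨le_min hr0 (by linarith), (min_le_right _ _).trans (by linarith)⟩
    rw [spreadOfRatio, Set.projIcc_of_mem zero_le_one hmem]
  rw [hval]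
  refine ⟨min_le_right _ _, ?_⟩
  have hp0 : 0 ≤ (φ : ℝ) / (1 + φ) := by positivity
  have hp1 : (φ : ℝ) / (1 + φ) ≤ 1 / 2 := by
    rw [div_le_div_iff₀ (by linarith) (by norm_num)]; linarith
  have hφp : (φ : ℝ) = (φ : ℝ) / (1 + φ) / (1 - (φ : ℝ) / (1 + φ)) := by
    have : (1 : ℝ) + φ ≠ 0 := by linarith
    field_simp
    ring
  rw [abs_sub_comm]
  refine (abs_sqrt_min_sub_le hφ).trans ?_
  have h1 := abs_sqrt_odds_sub_le hy0 hy1 hp0 hp1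
  rw [← hφp] at h1
  refine h1.trans ?_
  exact mul_le_mul_of_nonneg_left (abs_sqrt_min_sub_le hp1) (by norm_num)

theorem abs_sub_le_of_abs_sqrt_sub_le {φ ψ : unitInterval} {s : ℝ}
    (h : |√(φ : ℝ) - √(ψ : ℝ)| ≤ s) : |(φ : ℝ) - ψ| ≤ 2 * s := by
  have h1 : √(φ : ℝ) ≤ 1 := Real.sqrt_le_one.mpr φ.2.2
  have h2 : √(ψ : ℝ) ≤ 1 := Real.sqrt_le_one.mpr ψ.2.2
  have h3 := Real.sqrt_nonneg (φ : ℝ)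
  have h4 := Real.sqrt_nonneg (ψ : ℝ)
  rw [← Real.sq_sqrt φ.2.1, ← Real.sq_sqrt ψ.2.1, sq_sub_sq, abs_mul, abs_of_nonneg (by linarith)]
  nlinarith [abs_nonneg (√(φ : ℝ) - √(ψ : ℝ))]

end SpreadEstimate

/-! ### Stopping rules and their error probabilities under a fat truncation. -/

section Rules

variable {d : ℕ}

/-- The samples support the order of all neighbors in `π` with a score of at least `h`. -/
def OrderRule (h : ℝ) (S : Set (Ranking d)) (l : List (Ranking d)) (π : Ranking d) : Prop :=
  ∀ i j, (π j : ℕ) = π i + 1 → h ≤ (l.map (flipScore S i j)).sum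

/-- The item that `π` places first. -/
def firstItem (hd : 2 ≤ d) (π : Ranking d) : Fin d := π.symm ⟨0, by omega⟩

/-- The item that `π` places second. -/
def secondItem (hd : 2 ≤ d) (π : Ranking d) : Fin d := π.symm ⟨1, by omega⟩

/-- At least `M` samples stay in `S` when the first two items of `π` are swapped. -/
def CountRule (hd : 2 ≤ d) (M : ℝ) (S : Set (Ranking d)) (l : List (Ranking d))
    (π : Ranking d) : Prop :=
  M ≤ (l.map (flipCount S (firstItem hd π) (secondItem hd π))).sum

/-- The estimate of the spread parameter from the order of the first two items of `π`. -/
noncomputable def spreadEstimate (hd : 2 ≤ d) (γ : ℝ) (S : Set (Ranking d))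
    (l : List (Ranking d)) (π : Ranking d) : unitInterval :=
  spreadOfRatio γ ((l.map (flipDisc S (firstItem hd π) (secondItem hd π))).sum /
    (l.map (flipCount S (firstItem hd π) (secondItem hd π))).sum)

theorem second_eq_first_add_one (hd : 2 ≤ d) (π : Ranking d) :
    (π (secondItem hd π) : ℕ) = π (firstItem hd π) + 1 := by
  simp [firstItem, secondItem]

theorem ne_of_val_eq_add_one {π : Ranking d} {i j : Fin d} (h : (π j : ℕ) = π i + 1) :
    i ≠ j := by
  rintro rfl; omega

/-- A ranking is determined by the order in which its neighbors are placed. -/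
theorem eq_of_neighbors_lt {π π₀ : Ranking d}
    (h : ∀ i j, (π j : ℕ) = π i + 1 → π₀ i < π₀ j) : π = π₀ := by
  cases d with
  | zero => exact Subsingleton.elim _ _
  | succ n =>
    have hmono : StrictMono fun k => π₀ (π.symm k) := by
      rw [Fin.strictMono_iff_lt_succ]
      intro k
      exact h _ _ (by simp)
    have hid : (fun k => π₀ (π.symm k)) = id := by
      refine hmono.range_inj strictMono_id |>.mp ?_
      rw [Set.range_id]
      exact (π.symm.trans π₀).surjective.range_eq
    ext i
    have := congrFun hid (π i)
    simp only [Equiv.symm_apply_apply, id] at this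
    rw [this]

variable {π₀ : Ranking d} {φ : unitInterval} {S : Set (Ranking d)}
  {hS : ∃ π ∈ S, π ∈ (mallows π₀ φ).support} {γ α : ℝ}

theorem flipMass_mul_exp_le (hφ : (φ : ℝ) ≤ 1 - γ) {i j : Fin d} (h : π₀ i < π₀ j) :
    flipMass (truncatedMallows π₀ φ S hS) S j i * Real.exp γ ≤
      flipMass (truncatedMallows π₀ φ S hS) S i j := by
  have h1 := flipMass_swap_le hS h
  have h0 := flipMass_nonneg (truncatedMallows π₀ φ S hS) S i j
  have h2 : (φ : ℝ) * Real.exp γ ≤ 1 := by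
    have h3 := Real.add_one_le_exp (-γ)
    have h4 : Real.exp (-γ) * Real.exp γ = 1 := by rw [← Real.exp_add]; simp
    rw [← h4]
    gcongr
    linarith
  calc _ ≤ φ * flipMass (truncatedMallows π₀ φ S hS) S i j * Real.exp γ := by gcongr
    _ = φ * Real.exp γ * flipMass (truncatedMallows π₀ φ S hS) S i j := by ring
    _ ≤ _ := mul_le_of_le_one_left h0 h2

theorem le_flipMass_of_fat (hfat : IsNeighboringFat π₀ φ S hS α) {i j : Fin d}
    (h : (π₀ j : ℕ) = π₀ i + 1) :
    α ≤ flipMass (truncatedMallows π₀ φ S hS) S i j +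
      flipMass (truncatedMallows π₀ φ S hS) S j i := by
  refine le_flipMass_add_flipMass (ne_of_val_eq_add_one h) (hfat i j ?_)
  rw [h]
  push_cast
  simp

theorem fatness_le_one (hd : 2 ≤ d) (hfat : IsNeighboringFat π₀ φ S hS α) : α ≤ 1 :=
  (le_flipMass_of_fat hfat (second_eq_first_add_one hd π₀)).trans
    (flipMass_add_flipMass_le_one _ _ _ _)

theorem card_filter_pairs_le (P : Fin d × Fin d → Prop) [DecidablePred P] :
    ((Finset.univ.filter P).card : ℝ) ≤ (d : ℝ) ^ 2 := by
  have h := Finset.card_filter_le (Finset.univ : Finset (Fin d × Fin d)) P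
  rw [Finset.card_univ, Fintype.card_prod, Fintype.card_fin] at h
  rw [pow_two]
  exact_mod_cast h

theorem sum_ofReal_const_le (P : Fin d × Fin d → Prop) [DecidablePred P] {c : ℝ} (hc : 0 ≤ c) :
    ∑ _p ∈ Finset.univ.filter P, ENNReal.ofReal c ≤ ENNReal.ofReal ((d : ℝ) ^ 2 * c) := by
  rw [← ENNReal.ofReal_sum_of_nonneg fun _ _ => hc, Finset.sum_const, nsmul_eq_mul]
  refine ENNReal.ofReal_le_ofReal ?_
  gcongr
  exact card_filter_pairs_le P

/-- Accepting a wrong ranking requires that some pair, reversed with respect to `π₀`, has reached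
score `h`. The pair need not be adjacent in `π₀`, so the inequality `flipMass_swap_le` for arbitrary
pairs is needed, but no fatness. -/
theorem measure_exists_wrong_order_le (hγ : 0 < γ) (hφ : (φ : ℝ) ≤ 1 - γ) (h : ℝ) :
    (Measure.infinitePi fun _ : ℕ => (truncatedMallows π₀ φ S hS).toMeasure)
      {ω | ∃ n π, OrderRule h S ((List.range n).map ω) π ∧ π ≠ π₀} ≤
        ENNReal.ofReal ((d : ℝ) ^ 2 * Real.exp (-(γ * h))) := by
  classical
  refine le_trans (measure_mono (t := ⋃ p ∈ Finset.univ.filter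
      fun p : Fin d × Fin d => π₀ p.1 < π₀ p.2,
      {ω | ∃ n, h ≤ (((List.range n).map ω).map (flipScore S p.2 p.1)).sum}) ?_)
    ((measure_biUnion_finset_le _ _).trans
      (le_trans (Finset.sum_le_sum fun p hp => ?_)
        (sum_ofReal_const_le (fun p : Fin d × Fin d => π₀ p.1 < π₀ p.2) (Real.exp_pos _).le)))
  · rintro ω ⟨n, π, hR, hne⟩
    have hex : ∃ i j, (π j : ℕ) = π i + 1 ∧ ¬π₀ i < π₀ j := by
      by_contra hcon
      push Not at hcon
      exact hne (eq_of_neighbors_lt hcon)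
    obtain ⟨i, j, hij, hlt⟩ := hex
    have hlt' : π₀ j < π₀ i := lt_of_le_of_ne (not_lt.mp hlt)
      fun he => ne_of_val_eq_add_one hij (π₀.injective he).symm
    rw [Set.mem_iUnion₂]
    exact ⟨(j, i), by simpa using hlt', n, hR i j hij⟩
  · have hp' : π₀ p.1 < π₀ p.2 := by simpa using hp
    exact measure_exists_le_score_le (fun he => by rw [he] at hp'; exact lt_irrefl _ hp') hγ
      (flipMass_mul_exp_le hφ hp') h

theorem tsum_measure_not_orderRule_le (hd : 2 ≤ d) (hγ : 0 < γ) (hφ : (φ : ℝ) ≤ 1 - γ)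
    (hα : 0 < α) (hfat : IsNeighboringFat π₀ φ S hS α) {h : ℝ} (hh : 0 ≤ h) :
    ∑' n : ℕ, (Measure.infinitePi fun _ : ℕ => (truncatedMallows π₀ φ S hS).toMeasure)
      {ω | ¬OrderRule h S ((List.range n).map ω) π₀} ≤
        ENNReal.ofReal ((Real.log ((d : ℝ) ^ 2 * Real.exp (γ / 2 * h)) + 2) /
          (α * γ ^ 2 / 32)) := by
  classical
  have hα1 := fatness_le_one hd hfat
  have hγ1 : γ ≤ 1 := by linarith [φ.2.1]
  have hd' : (2 : ℝ) ≤ d := by exact_mod_cast hd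
  have hA : 1 ≤ (d : ℝ) ^ 2 * Real.exp (γ / 2 * h) :=
    one_le_mul_of_one_le_of_one_le (by nlinarith) (Real.one_le_exp (by positivity))
  have hρ : 0 < α * γ ^ 2 / 32 := by positivity
  have hρ1 : α * γ ^ 2 / 32 < 1 := by nlinarith
  refine le_trans (ENNReal.tsum_le_tsum fun n => le_min prob_le_one ?_)
    (tsum_min_one_geometric_le hA hρ hρ1)
  have hpos : 0 ≤ Real.exp (γ / 2 * h) * (1 - α * γ ^ 2 / 32) ^ n :=
    mul_nonneg (Real.exp_pos _).le (pow_nonneg (by linarith) _)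
  rw [mul_assoc]
  refine le_trans (measure_mono (t := ⋃ p ∈ Finset.univ.filter
      fun p : Fin d × Fin d => (π₀ p.2 : ℕ) = π₀ p.1 + 1,
      {ω | ¬h ≤ (((List.range n).map ω).map (flipScore S p.1 p.2)).sum}) ?_)
    ((measure_biUnion_finset_le _ _).trans
      (le_trans (Finset.sum_le_sum fun p hp => ?_)
        (sum_ofReal_const_le (fun p : Fin d × Fin d => (π₀ p.2 : ℕ) = π₀ p.1 + 1) hpos)))
  · intro ω hω
    have hω' : ¬∀ i j, (π₀ j : ℕ) = π₀ i + 1 →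
        h ≤ (((List.range n).map ω).map (flipScore S i j)).sum := hω
    push Not at hω'
    obtain ⟨i, j, hij, hlt⟩ := hω'
    rw [Set.mem_iUnion₂]
    exact ⟨(i, j), by simpa using hij, not_le.mpr hlt⟩
  · have hp' : (π₀ p.2 : ℕ) = π₀ p.1 + 1 := by simpa using hp
    exact measure_score_lt_le (ne_of_val_eq_add_one hp') hγ hγ1
      (flipMass_mul_exp_le hφ (by rw [Fin.lt_def]; omega)) (le_flipMass_of_fat hfat hp') hα1 h n

theorem tsum_measure_not_countRule_le (hd : 2 ≤ d) (hα : 0 < α)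
    (hfat : IsNeighboringFat π₀ φ S hS α) {M : ℝ} (hM : 0 ≤ M) :
    ∑' n : ℕ, (Measure.infinitePi fun _ : ℕ => (truncatedMallows π₀ φ S hS).toMeasure)
      {ω | ¬CountRule hd M S ((List.range n).map ω) π₀} ≤
        ENNReal.ofReal ((M + 2) / (α / 2)) := by
  have hα1 := fatness_le_one hd hfat
  have hadj := second_eq_first_add_one hd π₀
  have h := tsum_min_one_geometric_le (Real.one_le_exp hM) (half_pos hα) (by linarith)
  rw [Real.log_exp] at h
  refine le_trans (ENNReal.tsum_le_tsum fun n => le_min prob_le_one ?_) h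
  exact measure_count_lt_le (ne_of_val_eq_add_one hadj) (le_flipMass_of_fat hfat hadj) hα1 M n

theorem spreadEstimate_spec (hd : 2 ≤ d) (hγ : 0 < γ) (hφ : (φ : ℝ) ≤ 1 - γ)
    (S : Set (Ranking d)) (l : List (Ranking d)) (π : Ranking d) :
    (spreadEstimate hd γ S l π : ℝ) ≤ 1 - γ ∧
      |√(φ : ℝ) - √(spreadEstimate hd γ S l π : ℝ)| ≤
        4 * |√((l.map (flipDisc S (firstItem hd π) (secondItem hd π))).sum /
          (l.map (flipCount S (firstItem hd π) (secondItem hd π))).sum) -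
            √((φ : ℝ) / (1 + φ))| := by
  refine spreadOfRatio_spec hγ hφ (div_nonneg ?_ ?_)
  · refine List.sum_nonneg fun y hy => ?_
    obtain ⟨x, -, rfl⟩ := List.mem_map.mp hy
    unfold flipDisc
    split_ifs <;> simp
  · refine List.sum_nonneg fun y hy => ?_
    obtain ⟨x, -, rfl⟩ := List.mem_map.mp hy
    unfold flipCount
    split_ifs <;> simp

theorem measure_exists_wrong_spread_le (hd : 2 ≤ d) (hγ : 0 < γ) (hφ : (φ : ℝ) ≤ 1 - γ)
    {t M : ℝ} (ht : 0 < t) (hM : 0 < M) :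
    (Measure.infinitePi fun _ : ℕ => (truncatedMallows π₀ φ S hS).toMeasure)
      {ω | ∃ n, CountRule hd M S ((List.range n).map ω) π₀ ∧
        ¬|√(φ : ℝ) - √(spreadEstimate hd γ S ((List.range n).map ω) π₀ : ℝ)| ≤ 4 * t} ≤
        ENNReal.ofReal (2 * Real.exp (-(M * t ^ 2 / 4))) := by
  have hadj := second_eq_first_add_one hd π₀
  have hφ0 : (0 : ℝ) ≤ φ := φ.2.1
  have heq := flipMass_swap_eq hS hadj
  refine le_trans (measure_mono ?_) (measure_exists_sqrt_ratio_le
    (p := (φ : ℝ) / (1 + φ)) (S := S) (ne_of_val_eq_add_one hadj) (by positivity) ?_ ht hM)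
  · rintro ω ⟨n, hn, hbad⟩
    refine ⟨n, hn, ?_⟩
    by_contra hle
    rw [not_lt] at hle
    exact hbad ((spreadEstimate_spec hd hγ hφ S _ π₀).2.trans (by linarith))
  · rw [heq]
    have : (1 : ℝ) + φ ≠ 0 := by linarith
    field_simp

end Rules

/-! ### Choice of thresholds and arithmetic of the sample bounds. -/

section SampleSizes

theorem half_le_log {d : ℕ} (hd : 2 ≤ d) : 1 / 2 ≤ Real.log d := by
  have h1 : Real.log 2 ≤ Real.log d :=
    Real.log_le_log (by norm_num) (by exact_mod_cast hd)
  linarith [Real.log_two_gt_d9]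

theorem log_two_le_log {d : ℕ} (hd : 2 ≤ d) : Real.log 2 ≤ Real.log d :=
  Real.log_le_log (by norm_num) (by exact_mod_cast hd)

theorem log_four : Real.log 4 = 2 * Real.log 2 := by
  rw [show (4 : ℝ) = 2 ^ 2 by norm_num, Real.log_pow]; norm_num

/-- The score at which the order of two items counts as settled. -/
noncomputable def orderThreshold (d : ℕ) (γ δ : ℝ) : ℝ := Real.log ((d : ℝ) ^ 2 / δ) / γ

theorem orderThreshold_nonneg {d : ℕ} (hd : 2 ≤ d) {γ δ : ℝ} (hγ : 0 < γ) (hδ : 0 < δ)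
    (hδ1 : δ ≤ 1) : 0 ≤ orderThreshold d γ δ := by
  have hd' : (2 : ℝ) ≤ d := by exact_mod_cast hd
  refine div_nonneg (Real.log_nonneg ?_) hγ.le
  rw [le_div_iff₀ hδ]
  nlinarith

theorem sq_mul_exp_orderThreshold {d : ℕ} (hd : 2 ≤ d) {γ δ : ℝ} (hγ : 0 < γ) (hδ : 0 < δ) :
    (d : ℝ) ^ 2 * Real.exp (-(γ * orderThreshold d γ δ)) = δ := by
  have hd' : (0 : ℝ) < d := by exact_mod_cast (by omega : 0 < d)
  rw [orderThreshold, mul_div_cancel₀ _ hγ.ne', Real.exp_neg, Real.exp_log (by positivity)]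
  field_simp

/-- The slack `δ / 4 ≤ δ'` leaves room for halving the failure probability twice. The factor `log d`
is introduced only through `log d ≥ 1 / 2`. -/
theorem order_samples_le {d : ℕ} (hd : 2 ≤ d) {γ δ δ' α : ℝ} (hγ : 0 < γ) (hα : 0 < α)
    (hδ : 0 < δ) (hδ1 : δ < 1) (hδ' : δ / 4 ≤ δ') :
    (Real.log ((d : ℝ) ^ 2 * Real.exp (γ / 2 * orderThreshold d γ δ')) + 2) /
        (α * γ ^ 2 / 32) ≤
      1000 * (Real.log d * Real.log (d / δ) / (γ ^ 2 * α)) := by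
  have hd' : (0 : ℝ) < d := by exact_mod_cast (by omega : 0 < d)
  have hδ'0 : 0 < δ' := by linarith
  have hℓ := half_le_log hd
  have hℓ2 := log_two_le_log hd
  have hL : Real.log (d / δ) = Real.log d + -Real.log δ := by
    rw [Real.log_div hd'.ne' hδ.ne']; ring
  have hneg : 0 < -Real.log δ := by linarith [Real.log_neg hδ hδ1]
  have hlog' : -Real.log δ' ≤ -Real.log δ + 2 * Real.log 2 := by
    have h1 := Real.log_le_log (by linarith) hδ'
    rw [Real.log_div hδ.ne' (by norm_num), log_four] at h1
    linarith
  have hA : Real.log ((d : ℝ) ^ 2 * Real.exp (γ / 2 * orderThreshold d γ δ')) =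
      2 * Real.log d + (2 * Real.log d + -Real.log δ') / 2 := by
    rw [Real.log_mul (by positivity) (Real.exp_pos _).ne', Real.log_exp, Real.log_pow,
      orderThreshold, Real.log_div (by positivity) hδ'0.ne', Real.log_pow]
    field_simp
    push_cast
    ring
  have hAL : 2 * Real.log d + (2 * Real.log d + -Real.log δ') / 2 + 2 ≤
      8 * Real.log (d / δ) := by rw [hL]; linarith
  have hLL : 8 * Real.log (d / δ) ≤ 16 * (Real.log d * Real.log (d / δ)) := by
    have h0 : 0 ≤ Real.log (d / δ) := by rw [hL]; linarith
    nlinarith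
  have h0 : 0 ≤ Real.log d * Real.log (d / δ) := by
    rw [hL]; exact mul_nonneg (by linarith) (by linarith)
  rw [hA, div_le_iff₀ (by positivity)]
  have hR : 1000 * (Real.log d * Real.log (d / δ) / (γ ^ 2 * α)) * (α * γ ^ 2 / 32) =
      1000 / 32 * (Real.log d * Real.log (d / δ)) := by field_simp
  rw [hR]
  linarith

/-- A learner may give up at once with some probability when it may fail often. -/
theorem exists_restart_probability {δ : ℝ} (hδ : 0 < δ) (hδ1 : δ < 1) :
    ∃ q δ' : ℝ, 0 ≤ q ∧ q ≤ 1 ∧ 0 < δ' ∧ δ' ≤ 1 / 2 ∧ δ / 2 ≤ δ' ∧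
      q * (1 - δ') = 1 - δ ∧ q * -Real.log δ' ≤ 2 * Real.log (1 / δ) := by
  have hlog : Real.log (1 / δ) = -Real.log δ := by rw [one_div, Real.log_inv]
  have h1 := Real.log_le_sub_one_of_pos hδ
  rcases le_or_gt δ (1 / 2) with h | h
  · refine ⟨1, δ, by norm_num, le_rfl, hδ, h, by linarith, by ring, ?_⟩
    rw [hlog]
    linarith
  -- As `δ` tends to one the budget `log (1 / δ)` tends to zero, while any real experiment has a
  -- fixed cost. It is therefore run only with probability `2 * (1 - δ)`, at failure level `1 / 2`;
  -- then `1 - δ ≤ log (1 / δ)` pays for it.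
  · refine ⟨2 * (1 - δ), 1 / 2, by linarith, by linarith, by norm_num, le_rfl, by linarith,
      by ring, ?_⟩
    have h2 : -Real.log (1 / 2) = Real.log 2 := by rw [one_div, Real.log_inv, neg_neg]
    have h3 : Real.log 2 ≤ 1 := by linarith [Real.log_two_lt_d9]
    rw [hlog, h2]
    nlinarith

/-- The number of informative samples for an estimate with accuracy `t`. -/
noncomputable def countThreshold (t δ : ℝ) : ℝ := 4 / t ^ 2 * Real.log (4 / δ)

theorem countThreshold_pos {t δ : ℝ} (ht : 0 < t) (hδ : 0 < δ) (hδ1 : δ ≤ 1 / 2) :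
    0 < countThreshold t δ := by
  refine mul_pos (by positivity) (Real.log_pos ?_)
  rw [lt_div_iff₀ hδ]
  linarith

theorem two_mul_exp_countThreshold {t δ : ℝ} (ht : 0 < t) (hδ : 0 < δ) :
    2 * Real.exp (-(countThreshold t δ * t ^ 2 / 4)) = δ / 2 := by
  have h1 : countThreshold t δ * t ^ 2 / 4 = Real.log (4 / δ) := by
    rw [countThreshold]; field_simp
  rw [h1, Real.exp_neg, Real.exp_log (by positivity)]
  field_simp
  norm_num

theorem count_samples_le {t δ δ' q α : ℝ} (ht : 0 < t) (ht1 : t ≤ 1) (hα : 0 < α)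
    (hδ' : 0 < δ') (hδ'1 : δ' ≤ 1 / 2) (hq : 0 ≤ q)
    (hqlog : q * -Real.log δ' ≤ 2 * Real.log (1 / δ)) :
    q * ((countThreshold t δ' + 2) / (α / 2)) ≤ 100 * (Real.log (1 / δ) / (t ^ 2 * α)) := by
  have hlog2 : Real.log 2 ≤ -Real.log δ' := by
    have h1 := Real.log_le_log hδ' hδ'1
    rw [one_div, Real.log_inv] at h1
    linarith
  have h4 : Real.log (4 / δ') ≤ 3 * -Real.log δ' := by
    rw [Real.log_div (by norm_num) hδ'.ne', log_four]; linarith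
  have ht2 : t ^ 2 ≤ 1 := pow_le_one₀ ht.le ht1
  have hhalf : 1 / 2 ≤ -Real.log δ' := by linarith [Real.log_two_gt_d9]
  have hnum : (countThreshold t δ' + 2) * t ^ 2 ≤ 16 * -Real.log δ' := by
    have h1 : (countThreshold t δ' + 2) * t ^ 2 = 4 * Real.log (4 / δ') + 2 * t ^ 2 := by
      rw [countThreshold]; field_simp
    rw [h1]
    linarith
  have hL : q * ((countThreshold t δ' + 2) / (α / 2)) =
      2 * (q * ((countThreshold t δ' + 2) * t ^ 2)) / (t ^ 2 * α) := by field_simp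
  rw [hL, ← mul_div_assoc]
  refine div_le_div_of_nonneg_right ?_ (by positivity)
  have := mul_le_mul_of_nonneg_left hnum hq
  have h0 : 0 ≤ Real.log (1 / δ) := by
    have : 0 ≤ q * -Real.log δ' := mul_nonneg hq (by linarith)
    linarith
  linarith

end SampleSizes

/-! ### The three learners. -/

section Learners

theorem exists_center_learner {d : ℕ} (hd : 2 ≤ d) {γ δ : ℝ} (hγ : 0 < γ) (hδ : 0 < δ)
    (hδ1 : δ < 1) :
    ∃ L : Learner (Ranking d) (Ranking d),
      ∀ (π₀ : Ranking d) (φ : unitInterval), (φ : ℝ) ≤ 1 - γ →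
      ∀ (S : Set (Ranking d)) (hS : ∃ π ∈ S, π ∈ (mallows π₀ φ).support) (α : ℝ), 0 < α →
        IsNeighboringFat π₀ φ S hS α →
        ENNReal.ofReal (1 - δ) ≤
            L.successProb S (truncatedMallows π₀ φ S hS) (fun π => π = π₀) ∧
          L.expectedSamples S (truncatedMallows π₀ φ S hS) ≤
            ENNReal.ofReal (1000 * (Real.log d * Real.log (d / δ) / (γ ^ 2 * α))) := by
  refine ⟨searchLearner 1 zero_le_one le_rfl (OrderRule (orderThreshold d γ δ))
    (fun _ _ π => π) 1, fun π₀ φ hφ S hS α hα hfat => ?_⟩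
  have hbad := measure_exists_wrong_order_le (hS := hS) hγ hφ (orderThreshold d γ δ)
  rw [sq_mul_exp_orderThreshold hd hγ hδ] at hbad
  have hB := tsum_measure_not_orderRule_le hd hγ hφ hα hfat
    (orderThreshold_nonneg hd hγ hδ hδ1.le)
  have h := searchLearner_spec zero_le_one le_rfl (OrderRule (orderThreshold d γ δ))
    (fun _ _ π => π) 1 S (truncatedMallows π₀ φ S hS) (fun π => π = π₀) π₀ hδ.le hbad hB
  rw [one_mul, one_mul] at h
  exact ⟨h.1, h.2.trans (ENNReal.ofReal_le_ofReal
    (order_samples_le hd hγ hα hδ hδ1 (by linarith)))⟩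

theorem exists_spread_learner {d : ℕ} (hd : 2 ≤ d) {γ δ ε : ℝ} (hγ : 0 < γ) (hδ : 0 < δ)
    (hδ1 : δ < 1) (hε : 0 < ε) (π₀ : Ranking d) :
    ∃ L : Learner (Ranking d) ℝ,
      ∀ φ : unitInterval, (φ : ℝ) ≤ 1 - γ →
      ∀ (S : Set (Ranking d)) (hS : ∃ π ∈ S, π ∈ (mallows π₀ φ).support) (α : ℝ), 0 < α →
        IsNeighboringFat π₀ φ S hS α →
        ENNReal.ofReal (1 - δ) ≤
            L.successProb S (truncatedMallows π₀ φ S hS)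
              (fun φ' => |(φ : ℝ) - φ'| ≤ 8 * ε) ∧
          L.expectedSamples S (truncatedMallows π₀ φ S hS) ≤
            ENNReal.ofReal (100 * (Real.log (1 / δ) / (ε ^ 2 * α))) := by
  obtain ⟨q, δ', hq0, hq1, hδ'0, hδ'1, hδδ', hq, hqlog⟩ := exists_restart_probability hδ hδ1
  rcases le_or_gt ε 1 with hε1 | hε1
  · refine ⟨searchLearner q hq0 hq1
      (fun S l (_ : Unit) => CountRule hd (countThreshold ε δ') S l π₀)
      (fun S l _ => (spreadEstimate hd γ S l π₀ : ℝ)) 0, fun φ hφ S hS α hα hfat => ?_⟩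
    have hM := countThreshold_pos hε hδ'0 hδ'1
    have hbad := measure_exists_wrong_spread_le (hS := hS) hd hγ hφ hε hM
    rw [two_mul_exp_countThreshold hε hδ'0] at hbad
    have h := searchLearner_spec hq0 hq1
      (fun S l (_ : Unit) => CountRule hd (countThreshold ε δ') S l π₀)
      (fun S l _ => (spreadEstimate hd γ S l π₀ : ℝ)) 0 S (truncatedMallows π₀ φ S hS)
      (fun φ' => |(φ : ℝ) - φ'| ≤ 8 * ε) () hδ'0.le
      (le_trans (measure_mono ?_) (hbad.trans (ENNReal.ofReal_le_ofReal (by linarith))))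
      (tsum_measure_not_countRule_le hd hα hfat hM.le)
    · rw [hq] at h
      exact ⟨h.1, h.2.trans (ENNReal.ofReal_le_ofReal
        (count_samples_le hε hε1 hα hδ'0 hδ'1 hq0 hqlog))⟩
    · rintro ω ⟨n, -, hn, hne⟩
      refine ⟨n, hn, fun hle => hne ?_⟩
      have := abs_sub_le_of_abs_sqrt_sub_le hle
      linarith
  -- For `ε > 1` the constant answer `0` is already accurate enough.
  · refine ⟨searchLearner 1 zero_le_one le_rfl (fun _ _ (_ : Unit) => True)
      (fun _ _ _ => (0 : ℝ)) 0, fun φ hφ S hS α hα hfat => ?_⟩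
    have h := searchLearner_spec (B := 0) zero_le_one le_rfl (fun _ _ (_ : Unit) => True)
      (fun _ _ _ => (0 : ℝ)) 0 S (truncatedMallows π₀ φ S hS)
      (fun φ' => |(φ : ℝ) - φ'| ≤ 8 * ε) () le_rfl (by
        have : |(φ : ℝ) - 0| ≤ 8 * ε := by
          rw [sub_zero, abs_of_nonneg φ.2.1]; linarith [φ.2.2]
        simp only [this, not_true, and_false, exists_false]
        simp) (by simp)
    exact ⟨le_trans (ENNReal.ofReal_le_ofReal (by linarith)) h.1,
      h.2.trans (by simp)⟩

theorem exists_distribution_learner {d : ℕ} (hd : 2 ≤ d) {γ δ ε K : ℝ} (hγ : 0 < γ)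
    (hδ : 0 < δ) (hδ1 : δ < 1) (hε : 0 < ε) (hK1 : 1 ≤ K)
    (hK : ∀ (d : ℕ) (π₀ : Ranking d) (φ ψ : unitInterval), (φ : ℝ) ≤ 1 - γ →
      (ψ : ℝ) ≤ 1 - γ →
      tvDist (mallows π₀ φ) (mallows π₀ ψ) ≤ K * √d * |√(φ : ℝ) - √(ψ : ℝ)|) :
    ∃ L : Learner (Ranking d) (Ranking d × unitInterval),
      ∀ (π₀ : Ranking d) (φ : unitInterval), (φ : ℝ) ≤ 1 - γ →
      ∀ (S : Set (Ranking d)) (hS : ∃ π ∈ S, π ∈ (mallows π₀ φ).support) (α : ℝ), 0 < α →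
        IsNeighboringFat π₀ φ S hS α →
        ENNReal.ofReal (1 - δ) ≤
            L.successProb S (truncatedMallows π₀ φ S hS)
              (fun o => o.1 = π₀ ∧ tvDist (mallows π₀ φ) (mallows o.1 o.2) ≤ 4 * K * ε) ∧
          L.expectedSamples S (truncatedMallows π₀ φ S hS) ≤
            ENNReal.ofReal (1000 * (Real.log d * Real.log (d / δ) / (γ ^ 2 * α)
              + d * Real.log (1 / δ) / (ε ^ 2 * α))) := by
  have hd' : (0 : ℝ) < d := by exact_mod_cast (by omega : 0 < d)
  have hd1 : (1 : ℝ) ≤ d := by exact_mod_cast (by omega : 1 ≤ d)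
  have hlogδ : 0 ≤ Real.log (1 / δ) := Real.log_nonneg ((one_le_div hδ).mpr hδ1.le)
  rcases le_or_gt ε 1 with hε1 | hε1
  · obtain ⟨q, δ', hq0, hq1, hδ'0, hδ'1, hδδ', hq, hqlog⟩ := exists_restart_probability hδ hδ1
    -- The Lipschitz bound loses `√d`, which this accuracy compensates. The failure probability `δ'`
    -- is split evenly between order and spread.
    set t := ε / √d with ht
    set h := orderThreshold d γ (δ' / 2) with hh
    set M := countThreshold t δ' with hMdef
    have ht0 : 0 < t := div_pos hε (Real.sqrt_pos.mpr hd')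
    have ht1 : t ≤ 1 :=
      div_le_one_of_le₀ (hε1.trans (Real.one_le_sqrt.mpr hd1)) (Real.sqrt_nonneg _)
    have ht2 : t ^ 2 = ε ^ 2 / d := by rw [ht, div_pow, Real.sq_sqrt hd'.le]
    have hM := countThreshold_pos ht0 hδ'0 hδ'1
    refine ⟨searchLearner q hq0 hq1
      (fun S l π => OrderRule h S l π ∧ CountRule hd M S l π)
      (fun S l π => (π, spreadEstimate hd γ S l π)) (1, 0),
      fun π₀ φ hφ S hS α hα hfat => ?_⟩
    have hbad1 := measure_exists_wrong_order_le (hS := hS) hγ hφ h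
    rw [hh, sq_mul_exp_orderThreshold hd hγ (half_pos hδ'0), ← hh] at hbad1
    have hbad2 := measure_exists_wrong_spread_le (hS := hS) hd hγ hφ ht0 hM
    rw [two_mul_exp_countThreshold ht0 hδ'0] at hbad2
    have hB1 := tsum_measure_not_orderRule_le hd hγ hφ hα hfat
      (orderThreshold_nonneg hd hγ (half_pos hδ'0) (by linarith))
    have hB2 := tsum_measure_not_countRule_le hd hα hfat hM.le
    rw [← hh] at hB1
    have hs1 := order_samples_le hd hγ hα hδ hδ1 (δ' := δ' / 2) (by linarith)
    rw [← hh] at hs1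
    have hs2 := count_samples_le ht0 ht1 hα hδ'0 hδ'1 hq0 hqlog
    rw [← hMdef] at hs2 hB2 hbad2
    set B1 := (Real.log ((d : ℝ) ^ 2 * Real.exp (γ / 2 * h)) + 2) / (α * γ ^ 2 / 32)
    set B2 := (M + 2) / (α / 2) with hB2def
    have hB2nn : 0 ≤ B2 := div_nonneg (by linarith) (by linarith)
    have hB1nn : 0 ≤ B1 := by
      refine div_nonneg (add_nonneg (Real.log_nonneg ?_) zero_le_two) (by positivity)
      refine one_le_mul_of_one_le_of_one_le (one_le_pow₀ hd1) (Real.one_le_exp ?_)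
      exact mul_nonneg (by linarith)
        (orderThreshold_nonneg hd hγ (half_pos hδ'0) (by linarith))
    have hspec := searchLearner_spec (B := B1 + B2) hq0 hq1
      (fun S l π => OrderRule h S l π ∧ CountRule hd M S l π)
      (fun S l π => (π, spreadEstimate hd γ S l π)) (1, 0) S (truncatedMallows π₀ φ S hS)
      (fun o => o.1 = π₀ ∧ tvDist (mallows π₀ φ) (mallows o.1 o.2) ≤ 4 * K * ε) π₀ hδ'0.le
      (le_trans (measure_mono (t := _ ∪ _) ?_) ((measure_union_le _ _).trans
        ((add_le_add hbad1 hbad2).trans (le_of_eq ?_)))) ?_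
    · rw [hq] at hspec
      refine ⟨hspec.1, hspec.2.trans (ENNReal.ofReal_le_ofReal ?_)⟩
      have h1 : q * B1 ≤ B1 := mul_le_of_le_one_left hB1nn hq1
      have h2 : Real.log (1 / δ) / (t ^ 2 * α) = d * Real.log (1 / δ) / (ε ^ 2 * α) := by
        rw [ht2]; field_simp
      have h3 : 0 ≤ d * Real.log (1 / δ) / (ε ^ 2 * α) := by positivity
      rw [h2] at hs2
      linarith
    · rintro ω ⟨n, π, ⟨hn1, hn2⟩, hne⟩
      -- The spread is read off the first two items of the accepted ranking. If that ranking is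
      -- right, the time-uniform bound for `π₀` applies whatever the stopping time.
      by_cases hπ : π = π₀
      · subst hπ
        refine Or.inr ⟨n, hn2, fun hle => hne ⟨rfl, ?_⟩⟩
        refine (hK d π φ _ hφ (spreadEstimate_spec hd hγ hφ S _ π).1).trans ?_
        calc _ ≤ K * √d * (4 * t) := by gcongr
          _ = 4 * K * ε := by
            have : √(d : ℝ) ≠ 0 := (Real.sqrt_pos.mpr hd').ne'
            rw [ht]; field_simp
      · exact Or.inl ⟨n, π, hn1, hπ⟩
    · rw [← ENNReal.ofReal_add (by linarith) (by linarith), add_halves]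
    · rw [ENNReal.ofReal_add hB1nn hB2nn]
      refine le_trans ?_ (add_le_add hB1 hB2)
      rw [← ENNReal.tsum_add]
      refine ENNReal.tsum_le_tsum fun n => le_trans (measure_mono ?_) (measure_union_le _ _)
      intro ω hω
      exact not_and_or.mp hω
  -- For `ε > 1` the distance bound is trivial because `tvDist` is at most one, and only the center
  -- has to be learned.
  · refine ⟨searchLearner 1 zero_le_one le_rfl (OrderRule (orderThreshold d γ δ))
      (fun _ _ π => (π, 0)) (1, 0), fun π₀ φ hφ S hS α hα hfat => ?_⟩
    have hbad := measure_exists_wrong_order_le (hS := hS) hγ hφ (orderThreshold d γ δ)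
    rw [sq_mul_exp_orderThreshold hd hγ hδ] at hbad
    have hB := tsum_measure_not_orderRule_le hd hγ hφ hα hfat
      (orderThreshold_nonneg hd hγ hδ hδ1.le)
    have h := searchLearner_spec zero_le_one le_rfl (OrderRule (orderThreshold d γ δ))
      (fun _ _ π => (π, (0 : unitInterval))) (1, 0) S (truncatedMallows π₀ φ S hS)
      (fun o => o.1 = π₀ ∧ tvDist (mallows π₀ φ) (mallows o.1 o.2) ≤ 4 * K * ε) π₀ hδ.le
      (le_trans (measure_mono ?_) hbad) hB
    · rw [one_mul, one_mul] at h
      refine ⟨h.1, h.2.trans (ENNReal.ofReal_le_ofReal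
        ((order_samples_le hd hγ hα hδ hδ1 (by linarith)).trans ?_))⟩
      have h3 : 0 ≤ d * Real.log (1 / δ) / (ε ^ 2 * α) := by positivity
      linarith
    · rintro ω ⟨n, π, hn, hne⟩
      refine ⟨n, π, hn, fun hπ => hne ⟨hπ, (tvDist_le_one _ _).trans ?_⟩⟩
      nlinarith

theorem tvDist_eq_zero_of_subsingleton {X : Type*} [Fintype X] [Subsingleton X] (P Q : PMF X) :
    tvDist P Q = 0 := by
  have h : ∀ (R : PMF X) (x : X), R x = 1 := fun R x => by
    rw [← R.tsum_coe, tsum_fintype, Fintype.sum_subsingleton _ x]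
  simp [tvDist, h]

/-- The learner that stops at once. -/
theorem exists_idle_learner {d : ℕ} {Out : Type*} (o : Out) :
    ∃ L : Learner (Ranking d) Out, ∀ (S : Set (Ranking d)) (Q : PMF (Ranking d))
      (good : Out → Prop), good o →
      1 ≤ L.successProb S Q good ∧ L.expectedSamples S Q = 0 := by
  refine ⟨searchLearner 1 zero_le_one le_rfl (fun _ _ (_ : Unit) => True)
    (fun _ _ _ => o) o, fun S Q good hgood => ?_⟩
  have h := searchLearner_spec (B := 0) zero_le_one le_rfl (fun _ _ (_ : Unit) => True)
    (fun _ _ _ => o) o S Q good () le_rfl (by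
      simp only [hgood, not_true, and_false, exists_false]
      simp) (by simp)
  simpa using h

end Learners

theorem mainTheorem3 :
    ∃ C : ℝ, 0 < C ∧ ∀ γ : ℝ, 0 < γ → ∃ K : ℝ, 0 < K ∧
      ∀ (d : ℕ) (δ : ℝ), 0 < δ → δ < 1 →
      -- (i) learning the central ranking
      (∃ L : Learner (Ranking d) (Ranking d),
        ∀ (π₀ : Ranking d) (φ : unitInterval), (φ : ℝ) ≤ 1 - γ →
        ∀ (S : Set (Ranking d)) (hS : ∃ π ∈ S, π ∈ (mallows π₀ φ).support) (α : ℝ), 0 < α →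
          IsNeighboringFat π₀ φ S hS α →
          ENNReal.ofReal (1 - δ) ≤
              L.successProb S (truncatedMallows π₀ φ S hS) (fun π => π = π₀) ∧
            L.expectedSamples S (truncatedMallows π₀ φ S hS) ≤
              ENNReal.ofReal (C * (Real.log d * Real.log (d / δ) / (γ ^ 2 * α)))) ∧
      -- (ii) estimating the spread parameter when the central ranking is known
      (2 ≤ d → ∀ ε : ℝ, 0 < ε → ∀ π₀ : Ranking d,
        ∃ L : Learner (Ranking d) ℝ,
        ∀ φ : unitInterval, (φ : ℝ) ≤ 1 - γ →
        ∀ (S : Set (Ranking d)) (hS : ∃ π ∈ S, π ∈ (mallows π₀ φ).support) (α : ℝ), 0 < α →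
          IsNeighboringFat π₀ φ S hS α →
          ENNReal.ofReal (1 - δ) ≤
              L.successProb S (truncatedMallows π₀ φ S hS)
                (fun φ' => |(φ : ℝ) - φ'| ≤ C * ε) ∧
            L.expectedSamples S (truncatedMallows π₀ φ S hS) ≤
              ENNReal.ofReal (C * (Real.log (1 / δ) / (ε ^ 2 * α)))) ∧
      -- (iii) learning the distribution in total variation distance
      (∀ ε : ℝ, 0 < ε →
        ∃ L : Learner (Ranking d) (Ranking d × unitInterval),
        ∀ (π₀ : Ranking d) (φ : unitInterval), (φ : ℝ) ≤ 1 - γ →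
        ∀ (S : Set (Ranking d)) (hS : ∃ π ∈ S, π ∈ (mallows π₀ φ).support) (α : ℝ), 0 < α →
          IsNeighboringFat π₀ φ S hS α →
          ENNReal.ofReal (1 - δ) ≤
              L.successProb S (truncatedMallows π₀ φ S hS)
                (fun o => o.1 = π₀ ∧ tvDist (mallows π₀ φ) (mallows o.1 o.2) ≤ K * ε) ∧
            L.expectedSamples S (truncatedMallows π₀ φ S hS) ≤
              ENNReal.ofReal (C * (Real.log d * Real.log (d / δ) / (γ ^ 2 * α)
                + d * Real.log (1 / δ) / (ε ^ 2 * α)))) := by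

  refine ⟨1000, by norm_num, fun γ hγ => ?_⟩
  obtain ⟨K, hK1, hK⟩ := exists_tvDist_mallows_le hγ
  refine ⟨4 * K, by linarith, fun d δ hδ hδ1 => ?_⟩
  -- For `d ≤ 1` there is a single ranking and `log d = 0`, so the learner has to stop without any
  -- sample.
  rcases lt_or_ge d 2 with hd | hd
  · have hsub : Subsingleton (Fin d) := Fin.subsingleton_iff_le_one.mpr (by omega)
    have hsub' : Subsingleton (Ranking d) := inferInstance
    have hone : ENNReal.ofReal (1 - δ) ≤ 1 := ENNReal.ofReal_le_one.mpr (by linarith)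
    refine ⟨?_, fun h => absurd h (by omega), fun ε hε => ?_⟩
    · obtain ⟨L, hL⟩ := exists_idle_learner (d := d) (1 : Ranking d)
      refine ⟨L, fun π₀ φ _ S hS α _ _ => ?_⟩
      have h := hL S (truncatedMallows π₀ φ S hS) (fun π => π = π₀) (Subsingleton.elim _ _)
      exact ⟨hone.trans h.1, h.2.trans_le zero_le⟩
    · obtain ⟨L, hL⟩ := exists_idle_learner (d := d) ((1 : Ranking d), (0 : unitInterval))
      refine ⟨L, fun π₀ φ _ S hS α _ _ => ?_⟩
      have h := hL S (truncatedMallows π₀ φ S hS)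
        (fun o => o.1 = π₀ ∧ tvDist (mallows π₀ φ) (mallows o.1 o.2) ≤ 4 * K * ε)
        ⟨Subsingleton.elim _ _, by rw [tvDist_eq_zero_of_subsingleton]; positivity⟩
      exact ⟨hone.trans h.1, h.2.trans_le zero_le⟩
  · refine ⟨exists_center_learner hd hγ hδ hδ1, fun _ ε hε π₀ => ?_, fun ε hε =>
      exists_distribution_learner hd hγ hδ hδ1 hε hK1 hK⟩
    obtain ⟨L, hL⟩ := exists_spread_learner hd hγ hδ hδ1 hε π₀
    refine ⟨L, fun φ hφ S hS α hα hfat => ?_⟩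
    obtain ⟨h1, h2⟩ := hL φ hφ S hS α hα hfat
    have hlog : 0 ≤ Real.log (1 / δ) := Real.log_nonneg ((one_le_div hδ).mpr hδ1.le)
    refine ⟨h1.trans (measure_mono ?_), h2.trans (ENNReal.ofReal_le_ofReal ?_)⟩
    · rintro ω ⟨o, ho, hgood⟩
      exact ⟨o, ho, le_trans hgood (by linarith)⟩
    · have h3 : 0 ≤ Real.log (1 / δ) / (ε ^ 2 * α) := by positivity
      linarith
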